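/- Fix an integer $k\ge 2$. Let $\mathcal H(n,p,k)$ be the random $k$-uniform hypergraph on $n$ vertices in which each of the $\binom nk$ possible hyperedges is included independently with probability $p$. For a hypergraph $H$, a set of vertices is independent if it contains no hyperedge, and $\alpha(H)$ is the largest size of an independent set. There are a constant $C=C(k)>0$ and a deterministic polynomial-time algorithm $A$ which, given a $k$-uniform hypergraph $H$ and an integer $b\ge 0$, outputs either ``$\alpha(H)<b$'' or ``fail'', such that: 1. $A$ never errs: for every $k$-uniform hypergraph $H$ and every integer $b\ge0$, if $A$ outputs ``$\alpha(H)<b$'' on $(H,b)$, then indeed $\alpha(H)<b$. 2. Let $p=p(n)\in[0,1]$ and $\beta=\beta(n)\in\mathbb R$ be any sequences such that, for all sufficiently large $n$, $$\beta\ \ge\ n^{3/4}\log n\qquad\text{and}\qquad p\binom nk\ \ge\ C\cdot\frac{n^{5k/2}\,\log^3 n}{\beta^{2k}}.$$ Then $$\Pr_{H\sim\mathcal H(n,p,k)}\bigl[A(H,\lceil\beta\rceil)=\text{``fail''}\bigr]\longrightarrow 0\qquad(n\to\infty).$$ (Since $\alpha(H)$ is an integer, $\alpha(H)<\lceil\beta\rceil$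 is the same as $\alpha(H)<\beta$.) Here running time is that of a random access machine under logarithmic cost, and $H$ is given by its number of vertices $n$ and its $n^k$-entry $0/1$ adjacency tensor, and $b$ in binary; for fixed $k$, polynomial time thus means time polynomial in $n+\log(b+2)$. -/

import Mathlib

open Filter Topology

/-! ## Hypergraphs -/

/-- A `k`-uniform hypergraph on the vertex set `Fin n`, given by its set of hyperedges
(a set of `k`-element subsets of `Fin n`). -/
abbrev UniformHypergraph (n k : ℕ) : Type := Set {e : Finset (Fin n) // e.card = k}

namespace UniformHypergraph

/-- A vertex set is independent if it contains no hyperedge. -/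
def IsIndependent {n k : ℕ} (H : UniformHypergraph n k) (S : Finset (Fin n)) : Prop :=
  ∀ e ∈ H, ¬ (e : Finset (Fin n)) ⊆ S

/-- The independence number `α(H)`: the largest size of an independent set. -/
noncomputable def indepNumber {n k : ℕ} (H : UniformHypergraph n k) : ℕ :=
  sSup {m | ∃ S : Finset (Fin n), H.IsIndependent S ∧ S.card = m}

/-- The distribution `H(n,p,k)`: each of the `n.choose k` possible hyperedges is included
independently with probability `p`. -/
noncomputable def random (n k : ℕ) (p : unitInterval) :
    MeasureTheory.Measure (UniformHypergraph n k) :=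
  ProbabilityTheory.setBernoulli Set.univ p

open Classical in
/-- The input word for a pair `(H, β)`: the numbers `n` and `β`, followed by the `n ^ k` entries of
the `0/1` adjacency tensor of `H`. The entry with index `j` belongs to the `k`-tuple
of the base-`n` digits of `j`, and it is `1` iff the entries of the tuple form a hyperedge. -/
noncomputable def encode {n k : ℕ} (H : UniformHypergraph n k) (β : ℕ) : List ℕ :=
  n :: β :: List.ofFn fun j : Fin (n ^ k) =>
    if ∃ e ∈ H, (e : Finset (Fin n)) = Finset.univ.image (finFunctionFinEquiv.symm j)
    then 1 else 0

end UniformHypergraph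

/-! ## Random access machines with logarithmic cost -/

namespace RAM

/-- A state of the machine: named registers, and a memory that can be addressed indirectly.
Every cell holds a natural number. A program mentions only finitely many registers. -/
structure State where
  reg : ℕ → ℕ
  mem : ℕ → ℕ

/-- Arithmetic operations; subtraction is truncated at `0`, and division rounds down. -/
inductive Op
  | add | sub | mul | div

def Op.eval : Op → ℕ → ℕ → ℕ
  | .add, x, y => x + y
  | .sub, x, y => x - y
  | .mul, x, y => x * y
  | .div, x, y => x / y

/-- Programs. -/
inductive Program
  /-- `reg i := c` for a constant `c` -/
  | const (i c : ℕ)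
  /-- `reg i := reg j ∘ reg l` for an operation `∘` -/
  | arith (o : Op) (i j l : ℕ)
  /-- `reg i := mem (reg j)` -/
  | load (i j : ℕ)
  /-- `mem (reg i) := reg j` -/
  | store (i j : ℕ)
  /-- first `a`, then `b` -/
  | seq (a b : Program)
  /-- `a` if `reg i ≠ 0`, and `b` otherwise -/
  | branch (i : ℕ) (a b : Program)
  /-- repeat `a` while `reg i ≠ 0` -/
  | loop (i : ℕ) (a : Program)

/-- `Runs c s t s'`: the program `c`, started in the state `s`, halts in the state `s'` after
time `t`. Time is measured by logarithmic cost: an instruction costs one unit plus the binary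
lengths of all numbers (operands and memory addresses) that it handles. -/
inductive Runs : Program → State → ℕ → State → Prop
  | const (i c : ℕ) (s : State) :
      Runs (.const i c) s (1 + c.size) { s with reg := Function.update s.reg i c }
  | arith (o : Op) (i j l : ℕ) (s : State) :
      Runs (.arith o i j l) s (1 + (s.reg j).size + (s.reg l).size)
        { s with reg := Function.update s.reg i (o.eval (s.reg j) (s.reg l)) }
  | load (i j : ℕ) (s : State) :
      Runs (.load i j) s (1 + (s.reg j).size + (s.mem (s.reg j)).size)
        { s with reg := Function.update s.reg i (s.mem (s.reg j)) }
  | store (i j : ℕ) (s : State) :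
      Runs (.store i j) s (1 + (s.reg i).size + (s.reg j).size)
        { s with mem := Function.update s.mem (s.reg i) (s.reg j) }
  | seq {a b : Program} {s s' s'' : State} {t t' : ℕ} :
      Runs a s t s' → Runs b s' t' s'' → Runs (.seq a b) s (t + t') s''
  | branch_pos {i : ℕ} {a b : Program} {s s' : State} {t : ℕ} :
      s.reg i ≠ 0 → Runs a s t s' → Runs (.branch i a b) s (1 + (s.reg i).size + t) s'
  | branch_zero {i : ℕ} {a b : Program} {s s' : State} {t : ℕ} :
      s.reg i = 0 → Runs b s t s' → Runs (.branch i a b) s (1 + t) s'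
  | loop_pos {i : ℕ} {a : Program} {s s' s'' : State} {t t' : ℕ} :
      s.reg i ≠ 0 → Runs a s t s' → Runs (.loop i a) s' t' s'' →
        Runs (.loop i a) s (1 + (s.reg i).size + t + t') s''
  | loop_zero {i : ℕ} {a : Program} {s : State} :
      s.reg i = 0 → Runs (.loop i a) s 1 s

/-- The initial state on an input word: the word stands in the memory, its length in register `0`,
and everything else is `0`. -/
def init (x : List ℕ) : State where
  reg := Function.update 0 0 x.length
  mem := fun i => x.getD i 0

/-- The size of an input word: the total binary length of its entries, plus one for each entry. -/
def inputSize (x : List ℕ) : ℕ := (x.map fun a => 1 + a.size).sum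

/-- `f` is decided in polynomial time, for inputs encoded by `enc`: one program halts on every input
within a time (logarithmic cost) polynomial in the size of the input, and then register `0`
is nonzero iff the answer is `true`. -/
def DecidesInPolyTime {α : Type} (enc : α → List ℕ) (f : α → Bool) : Prop :=
  ∃ (c : Program) (q : Polynomial ℕ), ∀ a : α, ∃ (t : ℕ) (s : State),
    Runs c (init (enc a)) t s ∧ t ≤ q.eval (inputSize (enc a)) ∧ (f a = true ↔ s.reg 0 ≠ 0)

end RAM

/-! Let D = 4n^k, and give a k-set the weight D - j if it is a hyperedge and -j otherwise; for j/D
close to p this is D times a nearly centered variable. The refutation matrix B is indexed by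
(k-1)-tuples cut into two parts, and B(u,v) is the sum over i of w(u₁v₂i)·w(v₁u₂i), without the
terms whose two vertex sets coincide.

Soundness. Let S be independent with b elements. On the tuples from S, the swap (u,v) ↦
((u₁,v₂),(v₁,u₂)) turns the unmasked quadratic form into a sum over i of squares, and for i in S the
inner sum consists of terms -j and 0 only. So the form is large, of order b·(j·b^(k-1))², up to a
correction for the masked terms (`formBound_le`). Conversely, its L-th power, for L a power of two
and L ≥ 2, is at most b^((k-1)L)·tr B^L (`sum_sum_pow_le_trace`). A small trace therefore excludes
S, for every H and every j. The algorithm tries all j ≤ D, so it needs no knowledge of p.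

Success. Scale D away and put q = j/D. Expanding tr B^L over walks, a product of centered weights
has nonzero mean only if no hyperedge occurs exactly once, so at most L of the 2L factors are
distinct. Charging z for each new edge, one step of the walk costs a factor O((log n)²)
(`sum_pow_card_insert_le`), which gives `expect_trace_le`: for L of order log n the matrix behaves
as if its norm were O(log n · n^(k/2) · q). This beats the form when q·b^k is a large multiple of
n^(k/2)·log n, and the density hypothesis gives that because b ≤ n. Markov's inequality, applied to
the trace and to the number of tensor entries equal to 1, bounds the failure probability
(`expect_refute_eq_false_le`). `exists_grid_point` replaces p by a grid value j/D at the price of a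
factor 2.

Running time. The trace is a nonnegative integer with polynomially many bits, so it can be computed
modulo a larger number Q by repeated squaring. A calculus of `PolyComputable` functions, closed
under arithmetic and bounded loops, produces the machine program. -/

namespace RAM

/-! ### Binary lengths, and a calculus of polynomial-time RAM subroutines -/

theorem eval_mono_nat (q : Polynomial ℕ) : Monotone fun m : ℕ => q.eval m := by
  intro a b hab
  induction q using Polynomial.induction_on' with
  | add p q hp hq => simpa using add_le_add hp hq
  | monomial n c => simpa using Nat.mul_le_mul_left c (Nat.pow_le_pow_left hab n)

theorem size_add_le (a b : ℕ) : (a + b).size ≤ a.size + b.size + 1 := by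
  rw [Nat.size_le]
  have ha := Nat.lt_size_self a
  have hb := Nat.lt_size_self b
  have h1 : 2 ^ a.size ≤ 2 ^ (a.size + b.size) := Nat.pow_le_pow_right (by norm_num) (by omega)
  have h2 : 2 ^ b.size ≤ 2 ^ (a.size + b.size) := Nat.pow_le_pow_right (by norm_num) (by omega)
  rw [pow_succ]; omega

theorem size_mul_le (a b : ℕ) : (a * b).size ≤ a.size + b.size := by
  rw [Nat.size_le, pow_add]
  exact Nat.mul_lt_mul'' (Nat.lt_size_self a) (Nat.lt_size_self b)

theorem size_pow_le (a b : ℕ) : (a ^ b).size ≤ b * a.size + 1 := by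
  induction b with
  | zero => simp
  | succ b ih =>
    have := size_mul_le (a ^ b) a
    rw [pow_succ, Nat.succ_mul]; omega

theorem size_le_self (a : ℕ) : a.size ≤ a := Nat.size_le.2 Nat.lt_two_pow_self

theorem Op.size_eval_le (o : Op) (a b : ℕ) : (o.eval a b).size ≤ a.size + b.size + 1 := by
  cases o
  · exact size_add_le a b
  · exact (Nat.size_le_size (Nat.sub_le a b)).trans (by omega)
  · exact (size_mul_le a b).trans (by omega)
  · exact (Nat.size_le_size (Nat.div_le_self a b)).trans (by omega)

theorem size_sum_le {s : ℕ} (g : ℕ → ℕ) (m : ℕ) (h : ∀ i < m, (g i).size ≤ s) :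
    (∑ i ∈ Finset.range m, g i).size ≤ m + s := by
  induction m with
  | zero => simp
  | succ m ih =>
    have h1 := ih fun i hi => h i (by omega)
    have h2 := h m (by omega)
    rw [Nat.size_le] at *
    rw [Finset.sum_range_succ, show m + 1 + s = (m + s) + 1 by ring, pow_succ]
    have : 2 ^ s ≤ 2 ^ (m + s) := Nat.pow_le_pow_right (by norm_num) (by omega)
    omega

/-- A family of situations `x : X` in which a subroutine may be called: the contents of the
read-only memory, the values of the variables in scope, and a measure of their size. -/
structure Context (X : Type) where
  size : X → ℕ
  mem : X → ℕ → ℕ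
  size_mem_le : ∀ x a, (mem x a).size ≤ size x
  Var : Type
  var : Var → X → ℕ
  size_var_le : ∀ v x, (var v x).size ≤ size x

/-- The context with one more variable. -/
def Context.extend {X : Type} (Γ : Context X) : Context (X × ℕ) where
  size p := Γ.size p.1 + p.2.size
  mem p := Γ.mem p.1
  size_mem_le p a := (Γ.size_mem_le p.1 a).trans (Nat.le_add_right _ _)
  Var := Option Γ.Var
  var v p := v.elim p.2 fun w => Γ.var w p.1
  size_var_le v p := by
    cases v with
    | none => exact Nat.le_add_left _ _
    | some w => exact (Γ.size_var_le w p.1).trans (Nat.le_add_right _ _)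

/-- `f` is bounded by a polynomial in the size of the context. -/
def PolyBounded {X : Type} (Γ : Context X) (f : X → ℕ) : Prop :=
  ∃ q : Polynomial ℕ, ∀ x, f x ≤ q.eval (Γ.size x)

namespace PolyBounded

variable {X : Type} {Γ : Context X} {f g : X → ℕ}

theorem mono (hg : PolyBounded Γ g) (h : ∀ x, f x ≤ g x) : PolyBounded Γ f :=
  hg.imp fun _ hq x => (h x).trans (hq x)

theorem const (c : ℕ) : PolyBounded Γ fun _ => c := ⟨Polynomial.C c, by simp⟩

theorem size : PolyBounded Γ Γ.size := ⟨Polynomial.X, by simp⟩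

theorem add (hf : PolyBounded Γ f) (hg : PolyBounded Γ g) : PolyBounded Γ fun x => f x + g x := by
  obtain ⟨p, hp⟩ := hf
  obtain ⟨q, hq⟩ := hg
  exact ⟨p + q, fun x => by simpa using add_le_add (hp x) (hq x)⟩

theorem mul (hf : PolyBounded Γ f) (hg : PolyBounded Γ g) : PolyBounded Γ fun x => f x * g x := by
  obtain ⟨p, hp⟩ := hf
  obtain ⟨q, hq⟩ := hg
  exact ⟨p * q, fun x => by simpa using Nat.mul_le_mul (hp x) (hq x)⟩

theorem pow (hf : PolyBounded Γ f) (m : ℕ) : PolyBounded Γ fun x => f x ^ m := by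
  obtain ⟨p, hp⟩ := hf
  exact ⟨p ^ m, fun x => by simpa using Nat.pow_le_pow_left (hp x) m⟩

theorem comp (hf : PolyBounded Γ f) (q : Polynomial ℕ) : PolyBounded Γ fun x => q.eval (f x) := by
  obtain ⟨p, hp⟩ := hf
  exact ⟨q.comp p, fun x => by simpa using eval_mono_nat q (hp x)⟩

theorem size_of (hf : PolyBounded Γ f) : PolyBounded Γ fun x => (f x).size :=
  hf.mono fun _ => size_le_self _

theorem weaken (hf : PolyBounded Γ f) : PolyBounded Γ.extend fun p => f p.1 := by
  obtain ⟨p, hp⟩ := hf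
  exact ⟨p, fun x => (hp x.1).trans (eval_mono_nat p (Nat.le_add_right _ _))⟩

end PolyBounded

/-- In every situation of `Γ` whose variables are stored in the registers `ρ`, the program `c` puts
the value of `f` into register `d` within time `T`. It changes neither the memory nor a register
below `d`. -/
def Computes {X : Type} (Γ : Context X) (d : ℕ) (ρ : Γ.Var → ℕ) (c : Program) (f T : X → ℕ) :
    Prop :=
  ∀ (x : X) (s : State), s.mem = Γ.mem x → (∀ v, s.reg (ρ v) = Γ.var v x) →
    ∃ (t : ℕ) (s' : State), Runs c s t s' ∧ s'.reg d = f x ∧ (∀ r < d, s'.reg r = s.reg r) ∧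
      s'.mem = s.mem ∧ t ≤ T x

/-- `f` can be computed in polynomial time from the data of the context. -/
structure PolyComputable {X : Type} (Γ : Context X) (f : X → ℕ) : Prop where
  size_bounded : PolyBounded Γ fun x => (f x).size
  exists_program : ∃ T : X → ℕ, PolyBounded Γ T ∧
    ∀ (d : ℕ) (ρ : Γ.Var → ℕ), (∀ v, ρ v < d) → ∃ c, Computes Γ d ρ c f T

namespace PolyComputable

variable {X : Type} {Γ : Context X} {f g : X → ℕ}

theorem const (c : ℕ) : PolyComputable Γ fun _ => c where
  size_bounded := .const _
  exists_program := ⟨fun _ => 1 + c.size, .const _, fun d ρ hρ => ⟨.const d c, fun x s _ _ =>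
    ⟨_, _, .const d c s, by simp, fun r hr => by simp [hr.ne], rfl, le_rfl⟩⟩⟩

theorem var (v : Γ.Var) : PolyComputable Γ (Γ.var v) where
  size_bounded := PolyBounded.size.mono fun x => Γ.size_var_le v x
  exists_program := by
    -- There is no move instruction: the target is cleared and the source is added to it.
    refine ⟨fun x => 1 + (0 : ℕ).size + (1 + Γ.size x + (0 : ℕ).size), ?_, fun d ρ hρ =>
      ⟨.seq (.const d 0) (.arith .add d (ρ v) d), fun x s _ hv => ?_⟩⟩
    · exact (PolyBounded.const _).add (((PolyBounded.const _).add .size).add (.const _))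
    · refine ⟨_, _, .seq (.const d 0 s) (.arith .add d (ρ v) d _), ?_, fun r hr => ?_, rfl, ?_⟩
      · simp [Op.eval, (hρ v).ne, hv]
      · simp [hr.ne]
      · have := Γ.size_var_le v x
        simp only [Function.update_self, Function.update_of_ne (hρ v).ne, hv]
        omega

theorem load (hf : PolyComputable Γ f) : PolyComputable Γ fun x => Γ.mem x (f x) where
  size_bounded := PolyBounded.size.mono fun x => Γ.size_mem_le x _
  exists_program := by
    obtain ⟨T, hT, hc⟩ := hf.exists_program
    refine ⟨_, hT.add (((PolyBounded.const 1).add hf.size_bounded).add .size), fun d ρ hρ => ?_⟩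
    obtain ⟨c, hc⟩ := hc d ρ hρ
    refine ⟨.seq c (.load d d), fun x s hm hv => ?_⟩
    obtain ⟨t, s', hr, hd, hlt, hm', ht⟩ := hc x s hm hv
    refine ⟨_, _, .seq hr (.load d d s'), ?_, fun r hr => ?_, hm', ?_⟩
    · simp [hd, hm', hm]
    · simp [hr.ne, hlt r hr]
    · have := Γ.size_mem_le x (f x)
      simp only [hd, hm', hm]
      omega

/-- The second operand is computed with base register `d + 1`, so the first one survives in `d`.
Such nesting is possible because a subroutine exists for every base register, with one time bound
for all of them. -/
theorem op (o : Op) (hf : PolyComputable Γ f) (hg : PolyComputable Γ g) :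
    PolyComputable Γ fun x => o.eval (f x) (g x) where
  size_bounded := ((hf.size_bounded.add hg.size_bounded).add (.const 1)).mono
    fun x => Op.size_eval_le _ _ _
  exists_program := by
    obtain ⟨T, hT, hc⟩ := hf.exists_program
    obtain ⟨T', hT', hc'⟩ := hg.exists_program
    refine ⟨_, (hT.add hT').add (((PolyBounded.const 1).add hf.size_bounded).add hg.size_bounded),
      fun d ρ hρ => ?_⟩
    obtain ⟨c, hc⟩ := hc d ρ hρ
    obtain ⟨c', hc'⟩ := hc' (d + 1) ρ fun v => (hρ v).trans (Nat.lt_succ_self d)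
    refine ⟨.seq (.seq c c') (.arith o d d (d + 1)), fun x s hm hv => ?_⟩
    obtain ⟨t, s', hr, hd, hlt, hm', ht⟩ := hc x s hm hv
    obtain ⟨t', s'', hr', hd', hlt', hm'', ht'⟩ := hc' x s' (hm'.trans hm)
      fun v => (hlt _ (hρ v)).trans (hv v)
    refine ⟨_, _, .seq (.seq hr hr') (.arith o d d (d + 1) s''), ?_, fun r hr => ?_,
      hm''.trans hm', ?_⟩
    · simp [hd', hlt' d, hd]
    · simp [hr.ne, hlt' r (by omega), hlt r hr]
    · simp only [hd', hlt' d (Nat.lt_succ_self d), hd]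
      omega

theorem add (hf : PolyComputable Γ f) (hg : PolyComputable Γ g) :
    PolyComputable Γ fun x => f x + g x := op .add hf hg

theorem sub (hf : PolyComputable Γ f) (hg : PolyComputable Γ g) :
    PolyComputable Γ fun x => f x - g x := op .sub hf hg

theorem mul (hf : PolyComputable Γ f) (hg : PolyComputable Γ g) :
    PolyComputable Γ fun x => f x * g x := op .mul hf hg

theorem div (hf : PolyComputable Γ f) (hg : PolyComputable Γ g) :
    PolyComputable Γ fun x => f x / g x := op .div hf hg

theorem mod (hf : PolyComputable Γ f) (hg : PolyComputable Γ g) :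
    PolyComputable Γ fun x => f x % g x := by
  have h := hf.sub (hg.mul (hf.div hg))
  convert h using 2 with x
  rw [Nat.mod_eq_sub]

theorem weaken (hf : PolyComputable Γ f) : PolyComputable Γ.extend fun p => f p.1 where
  size_bounded := hf.size_bounded.weaken
  exists_program := by
    obtain ⟨T, hT, hc⟩ := hf.exists_program
    refine ⟨_, hT.weaken, fun d ρ hρ => ?_⟩
    obtain ⟨c, hc⟩ := hc d (fun v => ρ (some v)) fun v => hρ _
    exact ⟨c, fun x s hm hv => hc x.1 s hm fun v => hv (some v)⟩

theorem last : PolyComputable Γ.extend fun p => p.2 := var (Γ := Γ.extend) none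

/-- A loop that runs through `i = 0, …, bound x - 1` and updates an accumulator. -/
theorem fold {bound init : X → ℕ} {body : (X × ℕ) × ℕ → ℕ} {acc : X → ℕ → ℕ} {S : X → ℕ}
    (hbound : PolyComputable Γ bound) (hbound' : PolyBounded Γ bound)
    (hinit : PolyComputable Γ init) (hbody : PolyComputable Γ.extend.extend body)
    (hzero : ∀ x, acc x 0 = init x) (hsucc : ∀ x i, acc x (i + 1) = body ((x, i), acc x i))
    (hS : PolyBounded Γ S) (hacc : ∀ x, ∀ i ≤ bound x, (acc x i).size ≤ S x) :
    PolyComputable Γ fun x => acc x (bound x) where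
  size_bounded := hS.mono fun x => hacc x _ le_rfl
  exists_program := by
    obtain ⟨T₁, hT₁, hc₁⟩ := hbound.exists_program
    obtain ⟨T₂, hT₂, hc₂⟩ := hinit.exists_program
    obtain ⟨T₃, ⟨q, hq⟩, hc₃⟩ := hbody.exists_program
    -- Cost of one round: the body, copying the accumulator (at most `S`), and three operations on
    -- numbers up to the bound (increment, decrement, loop test); 6 collects the unit costs and the
    -- lengths of the constant 1.
    let K : X → ℕ := fun x =>
      q.eval (Γ.size x + (bound x).size + S x) + S x + 3 * (bound x).size + 6
    have hK : PolyBounded Γ K :=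
      ((((PolyBounded.comp ((PolyBounded.size.add hbound'.size_of).add hS) q).add hS).add
        ((PolyBounded.const 3).mul hbound'.size_of)).add (.const 6))
    refine ⟨fun x => T₂ x + T₁ x + 5 + (1 + bound x * K x),
      ((hT₂.add hT₁).add (.const 5)).add ((PolyBounded.const 1).add (hbound'.mul hK)),
      fun d ρ hρ => ?_⟩
    obtain ⟨c₂, hc₂⟩ := hc₂ d ρ hρ
    obtain ⟨c₁, hc₁⟩ := hc₁ (d + 1) ρ fun v => (hρ v).trans (by omega)
    -- Register layout: accumulator in `d`, remaining rounds in `d + 1`, index in `d + 2`, the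
    -- constants 1 and 0 in `d + 3` and `d + 4`, result of the body in `d + 5`. Two counters are
    -- needed because the loop stops at zero whereas the body expects an increasing index.
    let ρ' : Γ.extend.extend.Var → ℕ := fun v =>
      Option.elim v d fun w => Option.elim w (d + 2) ρ
    obtain ⟨c₃, hc₃⟩ := hc₃ (d + 5) ρ' (by
      rintro (_ | _ | v)
      · exact show d < d + 5 by omega
      · exact show d + 2 < d + 5 by omega
      · exact (hρ v).trans (by omega))
    let bodyc : Program := .seq (.seq (.seq c₃ (.arith .add d (d + 5) (d + 4)))
      (.arith .add (d + 2) (d + 2) (d + 3))) (.arith .sub (d + 1) (d + 1) (d + 3))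
    -- Loop invariant, by induction on the number `r` of remaining rounds.
    have main : ∀ (x : X) (r i : ℕ) (s : State), r + i = bound x → s.mem = Γ.mem x →
        (∀ v, s.reg (ρ v) = Γ.var v x) → s.reg d = acc x i → s.reg (d + 1) = r →
        s.reg (d + 2) = i → s.reg (d + 3) = 1 → s.reg (d + 4) = 0 →
        ∃ (t : ℕ) (s' : State), Runs (.loop (d + 1) bodyc) s t s' ∧ s'.reg d = acc x (bound x) ∧
          (∀ r < d, s'.reg r = s.reg r) ∧ s'.mem = s.mem ∧ t ≤ 1 + r * K x := by
      intro x r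
      induction r with
      | zero =>
        intro i s hi hm hv h0 h1 h2 h3 h4
        obtain rfl : i = bound x := by omega
        exact ⟨_, _, .loop_zero h1, h0, fun _ _ => rfl, rfl, by omega⟩
      | succ r ih =>
        intro i s hi hm hv h0 h1 h2 h3 h4
        obtain ⟨t, s', hrun, hd, hlt, hm', ht⟩ := hc₃ ((x, i), acc x i) s hm (by
          rintro (_ | _ | v)
          · exact h0
          · exact h2
          · exact hv v)
        have e1 := hlt (d + 1) (by omega)
        have e2 := hlt (d + 2) (by omega)
        have e3 := hlt (d + 3) (by omega)
        have e4 := hlt (d + 4) (by omega)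
        have hs0 : (acc x i).size ≤ S x := hacc x i (by omega)
        have hs1 : (acc x (i + 1)).size ≤ S x := hacc x (i + 1) (by omega)
        have hsi : i.size ≤ (bound x).size := Nat.size_le_size (by omega)
        have hsr : (r + 1).size ≤ (bound x).size := Nat.size_le_size (by omega)
        have hq' : T₃ ((x, i), acc x i) ≤ q.eval (Γ.size x + (bound x).size + S x) :=
          (hq _).trans (eval_mono_nat q (add_le_add (add_le_add le_rfl hsi) hs0))
        have hone : (1 : ℕ).size = 1 := by decide
        have hKx : K x = q.eval (Γ.size x + (bound x).size + S x) + S x +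
          3 * (bound x).size + 6 := rfl
        obtain ⟨t₁, s₁, hrun₁, ht₁, hm₁, hlt₁, g0, g1, g2, g3, g4⟩ : ∃ (t₁ : ℕ) (s₁ : State),
            Runs bodyc s t₁ s₁ ∧ 1 + (r + 1).size + t₁ ≤ K x ∧ s₁.mem = s.mem ∧
            (∀ w < d, s₁.reg w = s.reg w) ∧ s₁.reg d = acc x (i + 1) ∧ s₁.reg (d + 1) = r ∧
            s₁.reg (d + 2) = i + 1 ∧ s₁.reg (d + 3) = 1 ∧ s₁.reg (d + 4) = 0 := by
          refine ⟨_, _, Runs.seq (Runs.seq (Runs.seq hrun (.arith .add d (d + 5) (d + 4) s'))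
            (.arith .add (d + 2) (d + 2) (d + 3) _)) (.arith .sub (d + 1) (d + 1) (d + 3) _),
            ?_, hm', fun w hw => ?_, ?_, ?_, ?_, ?_, ?_⟩
          · simp [hd, e1, e2, e3, e4, h1, h2, h3, h4, ← hsucc, hone]
            omega
          · simp [hw.ne, (show w ≠ d + 1 by omega), (show w ≠ d + 2 by omega),
              hlt w (show w < d + 5 by omega)]
          · simp [Op.eval, hd, e4, h4, hsucc]
          · simp [Op.eval, e1, h1, e3, h3]
          · simp [Op.eval, e2, h2, e3, h3]
          · simp [e3, h3]
          · simp [e4, h4]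
        obtain ⟨t', s'', hrun', hd', hlt', hm'', ht'⟩ := ih (i + 1) s₁ (by omega)
          (hm₁.trans hm) (fun v => (hlt₁ _ (hρ v)).trans (hv v)) g0 g1 g2 g3 g4
        refine ⟨_, _, .loop_pos (by omega) hrun₁ hrun', hd',
          fun w hw => (hlt' w hw).trans (hlt₁ w hw), hm''.trans hm₁, ?_⟩
        rw [h1, Nat.succ_mul]
        omega
    refine ⟨.seq (.seq (.seq (.seq (.seq c₂ c₁) (.const (d + 2) 0)) (.const (d + 3) 1))
      (.const (d + 4) 0)) (.loop (d + 1) bodyc), fun x s hm hv => ?_⟩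
    obtain ⟨t₂, s₂, hr₂, hd₂, hlt₂, hm₂, ht₂⟩ := hc₂ x s hm hv
    obtain ⟨t₁, s₁, hr₁, hd₁, hlt₁, hm₁, ht₁⟩ := hc₁ x s₂ (hm₂.trans hm)
      fun v => (hlt₂ _ (hρ v)).trans (hv v)
    have hone : (1 : ℕ).size = 1 := by decide
    obtain ⟨t₀, s₀, hr₀, ht₀, hm₀, hlt₀, g0, g1, g2, g3, g4⟩ : ∃ (t₀ : ℕ) (s₀ : State),
        Runs (.seq (.seq (.seq (.seq c₂ c₁) (.const (d + 2) 0)) (.const (d + 3) 1))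
          (.const (d + 4) 0)) s t₀ s₀ ∧ t₀ ≤ T₂ x + T₁ x + 5 ∧ s₀.mem = s.mem ∧
        (∀ w < d, s₀.reg w = s.reg w) ∧ s₀.reg d = acc x 0 ∧ s₀.reg (d + 1) = bound x ∧
        s₀.reg (d + 2) = 0 ∧ s₀.reg (d + 3) = 1 ∧ s₀.reg (d + 4) = 0 := by
      refine ⟨_, _, .seq (.seq (.seq (.seq hr₂ hr₁) (.const (d + 2) 0 _))
        (.const (d + 3) 1 _)) (.const (d + 4) 0 _), ?_, hm₁.trans hm₂, fun w hw => ?_,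
        ?_, ?_, ?_, ?_, ?_⟩
      · simp only [hone, Nat.size_zero]
        omega
      · simp [(show w ≠ d + 2 by omega), (show w ≠ d + 3 by omega),
          (show w ≠ d + 4 by omega), hlt₁ w (by omega), hlt₂ w hw]
      · simp [hlt₁ d, hd₂, hzero]
      · simp [hd₁]
      · simp
      · simp
      · simp
    obtain ⟨t, s', hrun, hd, hlt, hm', ht⟩ := main x (bound x) 0 s₀ rfl (hm₀.trans hm)
      (fun v => (hlt₀ _ (hρ v)).trans (hv v)) g0 g1 g2 g3 g4
    exact ⟨_, _, .seq hr₀ hrun, hd, fun r hr => (hlt r hr).trans (hlt₀ r hr), hm'.trans hm₀,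
      by simp only []; omega⟩

theorem sum {bound : X → ℕ} {g : X × ℕ → ℕ} (hbound : PolyComputable Γ bound)
    (hbound' : PolyBounded Γ bound) (hg : PolyComputable Γ.extend g) :
    PolyComputable Γ fun x => ∑ i ∈ Finset.range (bound x), g (x, i) := by
  obtain ⟨q, hq⟩ := hg.size_bounded
  refine fold (S := fun x => bound x + q.eval (Γ.size x + bound x))
    (acc := fun x m => ∑ i ∈ Finset.range m, g (x, i)) (body := fun p => p.2 + g p.1)
    hbound hbound' (const 0) (last.add hg.weaken) (fun x => by simp)
    (fun x i => Finset.sum_range_succ _ _) (hbound'.add (.comp (.add .size hbound') q))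
    fun x i hi => ?_
  refine (size_sum_le (fun i => g (x, i)) i fun j hj => (hq (x, j)).trans (eval_mono_nat q ?_)).trans
    (Nat.add_le_add_right hi _)
  exact add_le_add le_rfl ((size_le_self j).trans (by omega))

/-- The exponent must be polynomially bounded in value, not just in length: it is the number of
rounds and also controls the length of the result. -/
theorem pow (hf : PolyComputable Γ f) (hg : PolyComputable Γ g) (hg' : PolyBounded Γ g) :
    PolyComputable Γ fun x => f x ^ g x := by
  refine fold (S := fun x => g x * (f x).size + 1)
    (acc := fun x m => f x ^ m) (body := fun p => p.2 * f p.1.1)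
    hg hg' (const 1) (last.mul hf.weaken.weaken) (fun x => by simp)
    (fun x i => pow_succ _ _) ((hg'.mul hf.size_bounded).add (.const 1)) fun x i hi => ?_
  exact (size_pow_le _ _).trans (Nat.add_le_add_right (Nat.mul_le_mul_right _ hi) _)

theorem pow_const (hf : PolyComputable Γ f) (m : ℕ) : PolyComputable Γ fun x => f x ^ m :=
  hf.pow (const m) (.const m)

theorem congr (hf : PolyComputable Γ f) (h : ∀ x, g x = f x) : PolyComputable Γ g := by
  rwa [show g = f from funext h]

end PolyComputable

end RAM

/-! ## The refutation algorithm as a function on natural numbers -/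

namespace Refutation

/-- The digit of `x` with index `c` in base `n`. -/
def digit (n x c : ℕ) : ℕ := x / n ^ c % n

/-- The indicator of `x = y`. -/
def eqInd (x y : ℕ) : ℕ := 1 - ((x - y) + (y - x))

/-- The number of pairs of equal digits among the first `k` digits of `x` and of `y`. -/
def coincidences (n k x y : ℕ) : ℕ :=
  ∑ c ∈ Finset.range k, ∑ c' ∈ Finset.range k, eqInd (digit n x c) (digit n y c')

/-- The indicator that the first `k` digits of `x` are distinct. -/
def distinctInd (n k x : ℕ) : ℕ := 1 - (coincidences n k x x - k)

/-- The indicator that the first `k` digits of `x` are distinct, those of `y` are distinct as well,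
and that they do not form the same set. -/
def maskInd (n k x y : ℕ) : ℕ :=
  distinctInd n k x * distinctInd n k y * (1 - (1 - (k - coincidences n k x y)))

/-- The code of the `k`-tuple that consists of the first part of `u`, the second part of `v`
and `i`. -/
def tupleCode (n k u v i : ℕ) : ℕ :=
  u % n ^ (k / 2) + v / n ^ (k / 2) * n ^ (k / 2) + i * n ^ (k - 1)

/-- An integer of the form `4 * n ^ k * a - j`, represented by a natural number modulo `Q`. -/
def centered (n k Q j a : ℕ) : ℕ := 4 * n ^ k * a + (Q - j)

/-- The entries of the refutation matrix, modulo `Q`. -/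
def entryCode (n k Q j : ℕ) (A : ℕ → ℕ) (u v : ℕ) : ℕ :=
  ∑ i ∈ Finset.range n, maskInd n k (tupleCode n k u v i) (tupleCode n k v u i) *
    (centered n k Q j (A (tupleCode n k u v i)) * centered n k Q j (A (tupleCode n k v u i)))

/-- The refutation matrix, encoded by one natural number with base-`Q` digits. -/
def matrixCode (n k Q j : ℕ) (A : ℕ → ℕ) : ℕ :=
  ∑ w ∈ Finset.range (n ^ (k - 1) * n ^ (k - 1)),
    entryCode n k Q j A (w / n ^ (k - 1)) (w % n ^ (k - 1)) % Q * Q ^ w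

/-- Squaring of an encoded `N × N` matrix. -/
def squareCode (N Q M : ℕ) : ℕ :=
  ∑ w ∈ Finset.range (N * N),
    (∑ m ∈ Finset.range N, digit Q M (w / N * N + m) * digit Q M (m * N + w % N)) % Q * Q ^ w

/-- Repeated squaring of an encoded matrix. -/
def powCode (N Q M : ℕ) : ℕ → ℕ
  | 0 => M
  | i + 1 => squareCode N Q (powCode N Q M i)

/-- The trace of an encoded matrix. -/
def traceCode (N Q M : ℕ) : ℕ := (∑ u ∈ Finset.range N, digit Q M (u * N + u)) % Q

/-- The number of squarings. -/
def squarings (n : ℕ) : ℕ := n.size.size + 1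

/-- The modulus. -/
def modulus (n k : ℕ) : ℕ := (16 * n ^ (3 * k)) ^ 2 ^ squarings n + 4 * n ^ k + 1

/-- The lower bound for the quadratic form of the refutation matrix at an independent set with `b`
elements, when `m` entries of the adjacency tensor are `1`. -/
def formBound (n k b j m : ℕ) : ℕ :=
  b * (j * (b + 1 - k) ^ (k - 1)) ^ 2 - k ^ k * ((4 * n ^ k) ^ 2 * m + j ^ 2 * n ^ k)

/-- The certificate with centering `j`: it is nonzero if it refutes independent sets of size `b`. -/
def certificate (n k b : ℕ) (A : ℕ → ℕ) (j : ℕ) : ℕ :=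
  formBound n k b j (∑ x ∈ Finset.range (n ^ k), A x) ^ 2 ^ squarings n -
    traceCode (n ^ (k - 1)) (modulus n k)
      (powCode (n ^ (k - 1)) (modulus n k) (matrixCode n k (modulus n k) j A) (squarings n)) *
      (b ^ (k - 1)) ^ 2 ^ squarings n

/-- The output of the algorithm; it is nonzero if independent sets of size `b` are refuted. -/
def output (n k b : ℕ) (A : ℕ → ℕ) : ℕ :=
  b - n + ∑ j ∈ Finset.range (4 * n ^ k + 1), certificate n k b A j

/-! ### Arithmetic of the encodings -/

theorem size_eq_sum (m : ℕ) :
    m.size = ∑ i ∈ Finset.range m, (1 - (2 ^ i - m)) := by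
  -- Truncated subtraction makes the term the indicator of 2^i ≤ m, that is, of i being below the
  -- binary length. A loop can therefore compute the length.
  have h : ∀ i, 1 - (2 ^ i - m) = if i < m.size then 1 else 0 := by
    intro i
    by_cases h : i < m.size
    · rw [if_pos h]
      have := Nat.lt_size.1 h
      omega
    · rw [if_neg h]
      have := mt Nat.lt_size.2 h
      omega
  simp_rw [h, Finset.sum_ite, Finset.sum_const_zero, add_zero, Finset.sum_const, smul_eq_mul,
    mul_one]
  rw [show (Finset.range m).filter (· < m.size) = Finset.range m.size by
    ext i
    have := RAM.size_le_self m
    simp only [Finset.mem_filter, Finset.mem_range]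
    omega]
  simp

theorem two_pow_size_le (m : ℕ) : 2 ^ m.size ≤ 2 * m + 1 := by
  rcases Nat.eq_zero_or_pos m with rfl | hm
  · simp
  · have h : 0 < m.size := Nat.size_pos.2 hm
    have := Nat.lt_size.1 (Nat.sub_lt h one_pos)
    have h2 : 2 ^ m.size = 2 * 2 ^ (m.size - 1) := by
      rw [← pow_succ']; congr 1; omega
    omega

/-- The trace exponent is only O(log n); this keeps the length of the modulus polynomial and is the
source of the logarithm in the norm bound. `lt_two_pow_two_pow_squarings` is the matching lower
estimate. -/
theorem two_pow_squarings_le (n : ℕ) : 2 ^ squarings n ≤ 4 * n.size + 2 := by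
  have := two_pow_size_le n.size
  rw [squarings, pow_succ]
  omega

theorem sum_mul_pow_lt {Q : ℕ} (a : ℕ → ℕ) (m : ℕ) (h : ∀ w < m, a w < Q) :
    ∑ w ∈ Finset.range m, a w * Q ^ w < Q ^ m := by
  induction m with
  | zero => simp
  | succ m ih =>
    rw [Finset.sum_range_succ, pow_succ]
    have h1 := ih fun w hw => h w (by omega)
    have h2 : (a m + 1) * Q ^ m ≤ Q * Q ^ m := Nat.mul_le_mul_right _ (h m (by omega))
    nlinarith

/-- Subroutines return one number and leave the memory alone, so a matrix travels as a base-Q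
expansion. Division by Q^c removes the lower digits, and reduction modulo Q the higher ones. -/
theorem digit_sum_mul_pow {Q : ℕ} (a : ℕ → ℕ) (m c : ℕ) (hc : c < m) (h : ∀ w < m, a w < Q) :
    digit Q (∑ w ∈ Finset.range m, a w * Q ^ w) c = a c := by
  have hQ : 0 < Q := (Nat.zero_le _).trans_lt (h c hc)
  induction m with
  | zero => omega
  | succ m ih =>
    rw [Finset.sum_range_succ, digit]
    rcases Nat.lt_succ_iff_lt_or_eq.1 hc with hlt | rfl
    · obtain ⟨e, rfl⟩ := Nat.exists_eq_add_of_lt hlt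
      rw [show a (c + e + 1) * Q ^ (c + e + 1) = Q ^ c * (Q * (a (c + e + 1) * Q ^ e)) by ring,
        Nat.add_mul_div_left _ _ (pow_pos hQ c), Nat.add_mul_mod_self_left]
      exact ih hlt fun w hw => h w (by omega)
    · rw [Nat.add_mul_div_right _ _ (pow_pos hQ c),
        Nat.div_eq_of_lt (sum_mul_pow_lt a c fun w hw => h w (by omega)), zero_add,
        Nat.mod_eq_of_lt (h c hc)]

theorem squareCode_lt (N M : ℕ) {Q : ℕ} (hQ : 0 < Q) : squareCode N Q M < Q ^ (N * N) :=
  sum_mul_pow_lt _ _ fun _ _ => Nat.mod_lt _ hQ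

theorem powCode_lt {N M Q : ℕ} (hQ : 0 < Q) (hM : M < Q ^ (N * N)) (i : ℕ) :
    powCode N Q M i < Q ^ (N * N) := by
  cases i with
  | zero => exact hM
  | succ i => exact squareCode_lt N _ hQ

theorem matrixCode_lt (n k j : ℕ) {Q : ℕ} (hQ : 0 < Q) (A : ℕ → ℕ) :
    matrixCode n k Q j A < Q ^ (n ^ (k - 1) * n ^ (k - 1)) :=
  sum_mul_pow_lt _ _ fun _ _ => Nat.mod_lt _ hQ

end Refutation

/-! ## The algorithm runs in polynomial time -/

namespace RAM

namespace PolyComputable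

open Refutation

variable {X : Type} {Γ : Context X} {n N Q M j b u v i x y c : X → ℕ}

theorem digit (hn : PolyComputable Γ n) (hx : PolyComputable Γ x) (hc : PolyComputable Γ c)
    (hc' : PolyBounded Γ c) : PolyComputable Γ fun p => Refutation.digit (n p) (x p) (c p) :=
  (hx.div (hn.pow hc hc')).mod hn

theorem eqInd (hx : PolyComputable Γ x) (hy : PolyComputable Γ y) :
    PolyComputable Γ fun p => Refutation.eqInd (x p) (y p) :=
  (const 1).sub ((hx.sub hy).add (hy.sub hx))

theorem coincidences (k : ℕ) (hn : PolyComputable Γ n) (hx : PolyComputable Γ x)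
    (hy : PolyComputable Γ y) :
    PolyComputable Γ fun p => Refutation.coincidences (n p) k (x p) (y p) := by
  -- A loop variable is an arbitrary natural number in the extended context, so as an exponent it
  -- has no polynomial bound. Reducing it modulo `k + 1` supplies one and changes nothing on the
  -- range of the sum.
  have h2 : PolyComputable Γ.extend.extend fun q => Refutation.eqInd
      (Refutation.digit (n q.1.1) (x q.1.1) (q.1.2 % (k + 1)))
      (Refutation.digit (n q.1.1) (y q.1.1) (q.2 % (k + 1))) := by
    have hb : ∀ g : (X × ℕ) × ℕ → ℕ, PolyBounded Γ.extend.extend fun q => g q % (k + 1) :=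
      fun g => (PolyBounded.const (k + 1)).mono fun q => (Nat.mod_lt _ k.succ_pos).le
    exact (hn.weaken.weaken.digit hx.weaken.weaken (last.weaken.mod (const _)) (hb _)).eqInd
      (hn.weaken.weaken.digit hy.weaken.weaken (last.mod (const _)) (hb _))
  refine (sum (const k) (.const k) (sum (const k) (.const k) h2)).congr fun p => ?_
  refine Finset.sum_congr rfl fun c hc => Finset.sum_congr rfl fun c' hc' => ?_
  rw [Finset.mem_range] at hc hc'
  simp only [Nat.mod_eq_of_lt (hc.trans k.lt_succ_self), Nat.mod_eq_of_lt (hc'.trans k.lt_succ_self)]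

theorem distinctInd (k : ℕ) (hn : PolyComputable Γ n) (hx : PolyComputable Γ x) :
    PolyComputable Γ fun p => Refutation.distinctInd (n p) k (x p) :=
  (const 1).sub ((coincidences k hn hx hx).sub (const k))

theorem maskInd (k : ℕ) (hn : PolyComputable Γ n) (hx : PolyComputable Γ x)
    (hy : PolyComputable Γ y) :
    PolyComputable Γ fun p => Refutation.maskInd (n p) k (x p) (y p) :=
  ((distinctInd k hn hx).mul (distinctInd k hn hy)).mul
    ((const 1).sub ((const 1).sub ((const k).sub (coincidences k hn hx hy))))

theorem tupleCode (k : ℕ) (hn : PolyComputable Γ n) (hu : PolyComputable Γ u)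
    (hv : PolyComputable Γ v) (hi : PolyComputable Γ i) :
    PolyComputable Γ fun p => Refutation.tupleCode (n p) k (u p) (v p) (i p) :=
  ((hu.mod (hn.pow_const _)).add ((hv.div (hn.pow_const _)).mul (hn.pow_const _))).add
    (hi.mul (hn.pow_const _))

theorem centered (k : ℕ) (hn : PolyComputable Γ n) (hQ : PolyComputable Γ Q)
    (hj : PolyComputable Γ j) (hx : PolyComputable Γ x) :
    PolyComputable Γ fun p => Refutation.centered (n p) k (Q p) (j p) (x p) :=
  (((const 4).mul (hn.pow_const k)).mul hx).add (hQ.sub hj)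

theorem tensor (hx : PolyComputable Γ x) : PolyComputable Γ fun p => Γ.mem p (2 + x p) :=
  ((const 2).add hx).load

theorem entryCode (k : ℕ) (hn : PolyComputable Γ n) (hn' : PolyBounded Γ n)
    (hQ : PolyComputable Γ Q) (hj : PolyComputable Γ j) (hu : PolyComputable Γ u)
    (hv : PolyComputable Γ v) :
    PolyComputable Γ fun p =>
      Refutation.entryCode (n p) k (Q p) (j p) (fun a => Γ.mem p (2 + a)) (u p) (v p) := by
  have h1 := tupleCode k hn.weaken hu.weaken hv.weaken last
  have h2 := tupleCode k hn.weaken hv.weaken hu.weaken last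
  exact sum hn hn' ((maskInd k hn.weaken h1 h2).mul
    ((centered k hn.weaken hQ.weaken hj.weaken h1.tensor).mul
      (centered k hn.weaken hQ.weaken hj.weaken h2.tensor)))

theorem sum_mul_pow {bound : X → ℕ} {g : X × ℕ → ℕ} (hQ : PolyComputable Γ Q)
    (hbound : PolyComputable Γ bound)
    (hbound' : PolyBounded Γ bound) (hg : PolyComputable Γ.extend g) :
    PolyComputable Γ fun x => ∑ w ∈ Finset.range (bound x), g (x, w) % Q x * Q x ^ w := by
  have h : PolyComputable Γ.extend fun p => g p % Q p.1 * Q p.1 ^ (p.2 % (bound p.1 + 1)) :=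
    (hg.mod hQ.weaken).mul (hQ.weaken.pow (last.mod (hbound.weaken.add (const 1)))
      ((hbound'.weaken.add (.const 1)).mono fun p => (Nat.mod_lt _ (Nat.succ_pos _)).le))
  refine (sum hbound hbound' h).congr fun p => Finset.sum_congr rfl fun w hw => ?_
  rw [Finset.mem_range] at hw
  simp only [Nat.mod_eq_of_lt (show w < bound p + 1 by omega)]

theorem matrixCode (k : ℕ) (hn : PolyComputable Γ n) (hn' : PolyBounded Γ n)
    (hQ : PolyComputable Γ Q) (hj : PolyComputable Γ j) :
    PolyComputable Γ fun p =>
      Refutation.matrixCode (n p) k (Q p) (j p) fun a => Γ.mem p (2 + a) := by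
  have hN := hn.pow_const (k - 1)
  exact sum_mul_pow hQ (hN.mul hN) ((hn'.pow _).mul (hn'.pow _))
    (entryCode k hn.weaken hn'.weaken hQ.weaken hj.weaken (last.div hN.weaken)
      (last.mod hN.weaken))

theorem squareCode (hN : PolyComputable Γ N) (hN' : PolyBounded Γ N)
    (hQ : PolyComputable Γ Q) (hM : PolyComputable Γ M) :
    PolyComputable Γ fun p => Refutation.squareCode (N p) (Q p) (M p) := by
  have hN2 := hN.mul hN
  have hN2' := hN'.mul hN'
  -- all positions of digits are reduced modulo a polynomial bound, which changes nothing
  have hpos : ∀ {g : (X × ℕ) × ℕ → ℕ}, PolyComputable Γ.extend.extend g →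
      PolyComputable Γ.extend.extend fun q =>
        Refutation.digit (Q q.1.1) (M q.1.1) (g q % (N q.1.1 * N q.1.1 + 1)) := fun hg =>
    digit hQ.weaken.weaken hM.weaken.weaken (hg.mod (hN2.weaken.weaken.add (const 1)))
      ((hN2'.weaken.weaken.add (.const 1)).mono fun p => (Nat.mod_lt _ (Nat.succ_pos _)).le)
  have hin := sum hN.weaken hN'.weaken
    ((hpos (((last.weaken.div hN.weaken.weaken).mul hN.weaken.weaken).add last)).mul
      (hpos ((last.mul hN.weaken.weaken).add (last.weaken.mod hN.weaken.weaken))))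
  refine (sum_mul_pow hQ hN2 hN2' hin).congr fun p => Finset.sum_congr rfl fun w hw => ?_
  congr 2
  refine Finset.sum_congr rfl fun m hm => ?_
  rw [Finset.mem_range] at hw
  have hm : m < N p := Finset.mem_range.1 hm
  have hpos : 0 < N p := by omega
  have h1 : w / N p < N p := Nat.div_lt_of_lt_mul hw
  have h2 : w % N p < N p := Nat.mod_lt _ hpos
  have h3 : w / N p * N p + m < N p * N p + 1 := by nlinarith
  have h4 : m * N p + w % N p < N p * N p + 1 := by nlinarith
  simp only [Nat.mod_eq_of_lt h3, Nat.mod_eq_of_lt h4]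

/-- Entries are reduced modulo Q after every squaring, so all iterates stay below Q^(N·N) and the
accumulator of the loop does not grow. -/
theorem powCode (hN : PolyComputable Γ N) (hN' : PolyBounded Γ N)
    (hQ : PolyComputable Γ Q) (hM : PolyComputable Γ M) (hi : PolyComputable Γ i)
    (hi' : PolyBounded Γ i) (hQpos : ∀ p, 0 < Q p) (hMlt : ∀ p, M p < Q p ^ (N p * N p)) :
    PolyComputable Γ fun p => Refutation.powCode (N p) (Q p) (M p) (i p) := by
  refine fold (acc := fun p => Refutation.powCode (N p) (Q p) (M p))
    (S := fun p => N p * N p * (Q p).size + 1) hi hi' hM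
    (squareCode hN.weaken.weaken hN'.weaken.weaken hQ.weaken.weaken last)
    (fun _ => rfl) (fun _ _ => rfl) (((hN'.mul hN').mul hQ.size_bounded).add (.const 1))
    fun p i _ => ?_
  exact (Nat.size_le_size (powCode_lt (hQpos p) (hMlt p) i).le).trans (size_pow_le _ _)

theorem traceCode (hN : PolyComputable Γ N) (hN' : PolyBounded Γ N)
    (hQ : PolyComputable Γ Q) (hM : PolyComputable Γ M) :
    PolyComputable Γ fun p => Refutation.traceCode (N p) (Q p) (M p) := by
  have h : PolyComputable Γ.extend fun p => Refutation.digit (Q p.1) (M p.1)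
      ((p.2 * N p.1 + p.2) % (N p.1 * N p.1 + N p.1 + 1)) :=
    digit hQ.weaken hM.weaken (((last.mul hN.weaken).add last).mod
      (((hN.mul hN).add hN).add (const 1)).weaken)
      ((((hN'.mul hN').add hN').add (.const 1)).weaken.mono
        fun p => (Nat.mod_lt _ (Nat.succ_pos _)).le)
  refine ((sum hN hN' h).mod hQ).congr fun p => ?_
  rw [Refutation.traceCode]
  congr 1
  refine Finset.sum_congr rfl fun w hw => ?_
  rw [Finset.mem_range] at hw
  simp only [Nat.mod_eq_of_lt (show w * N p + w < N p * N p + N p + 1 by nlinarith)]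

theorem size (hx : PolyComputable Γ x) (hx' : PolyBounded Γ x) :
    PolyComputable Γ fun p => (x p).size := by
  have h : PolyComputable Γ.extend fun p => 1 - (2 ^ (p.2 % (x p.1 + 1)) - x p.1) :=
    (const 1).sub (((const 2).pow (last.mod (hx.weaken.add (const 1)))
      ((hx'.weaken.add (.const 1)).mono fun p => (Nat.mod_lt _ (Nat.succ_pos _)).le)).sub hx.weaken)
  refine (sum hx hx' h).congr fun p => ?_
  rw [size_eq_sum]
  refine Finset.sum_congr rfl fun w hw => ?_
  rw [Finset.mem_range] at hw
  simp only [Nat.mod_eq_of_lt (show w < x p + 1 by omega)]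

theorem polyBounded_squarings (hn' : PolyBounded Γ n) :
    PolyBounded Γ fun p => squarings (n p) :=
  (hn'.size_of.size_of).add (.const 1)

theorem squarings (hn : PolyComputable Γ n) (hn' : PolyBounded Γ n) :
    PolyComputable Γ fun p => Refutation.squarings (n p) :=
  (size (size hn hn') hn'.size_of).add (const 1)

theorem polyBounded_two_pow_squarings (hn' : PolyBounded Γ n) :
    PolyBounded Γ fun p => 2 ^ Refutation.squarings (n p) :=
  (((PolyBounded.const 4).mul hn'.size_of).add (.const 2)).mono fun _ => two_pow_squarings_le _

theorem two_pow_squarings (hn : PolyComputable Γ n) (hn' : PolyBounded Γ n) :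
    PolyComputable Γ fun p => 2 ^ Refutation.squarings (n p) :=
  (const 2).pow (squarings hn hn') (polyBounded_squarings hn')

theorem modulus (k : ℕ) (hn : PolyComputable Γ n) (hn' : PolyBounded Γ n) :
    PolyComputable Γ fun p => Refutation.modulus (n p) k :=
  ((((const 16).mul (hn.pow_const _)).pow (two_pow_squarings hn hn')
    (polyBounded_two_pow_squarings hn')).add ((const 4).mul (hn.pow_const _))).add (const 1)

theorem formBound (k : ℕ) (hn : PolyComputable Γ n) (hb : PolyComputable Γ b)
    (hj : PolyComputable Γ j) (hx : PolyComputable Γ x) :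
    PolyComputable Γ fun p => Refutation.formBound (n p) k (b p) (j p) (x p) :=
  (hb.mul ((hj.mul (((hb.add (const 1)).sub (const k)).pow_const _)).pow_const _)).sub
    ((const (k ^ k)).mul (((((const 4).mul (hn.pow_const _)).pow_const _).mul hx).add
      ((hj.pow_const _).mul (hn.pow_const _))))

theorem certificate (k : ℕ) (hn : PolyComputable Γ n) (hn' : PolyBounded Γ n)
    (hb : PolyComputable Γ b) (hj : PolyComputable Γ j) :
    PolyComputable Γ fun p =>
      Refutation.certificate (n p) k (b p) (fun a => Γ.mem p (2 + a)) (j p) := by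
  have hQ := modulus k hn hn'
  have hN := hn.pow_const (k - 1)
  have hN' := hn'.pow (k - 1)
  have hpos : ∀ p, 0 < Refutation.modulus (n p) k := fun p => Nat.succ_pos _
  have hsum := sum (hn.pow_const k) (hn'.pow k) (tensor (Γ := Γ.extend) last)
  exact ((formBound k hn hb hj hsum).pow (two_pow_squarings hn hn')
    (polyBounded_two_pow_squarings hn')).sub
    ((traceCode hN hN' hQ (powCode hN hN' hQ (matrixCode k hn hn' hQ hj) (squarings hn hn')
      (polyBounded_squarings hn') hpos fun p => matrixCode_lt _ _ _ (hpos p) _)).mul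
      ((hb.pow_const _).pow (two_pow_squarings hn hn') (polyBounded_two_pow_squarings hn')))

theorem output (k : ℕ) (hn : PolyComputable Γ n) (hn' : PolyBounded Γ n)
    (hb : PolyComputable Γ b) :
    PolyComputable Γ fun p => Refutation.output (n p) k (b p) fun a => Γ.mem p (2 + a) := by
  have hbound : PolyComputable Γ fun p => 4 * n p ^ k + 1 :=
    ((const 4).mul (hn.pow_const k)).add (const 1)
  have hbound' : PolyBounded Γ fun p => 4 * n p ^ k + 1 :=
    ((PolyBounded.const 4).mul (hn'.pow k)).add (.const 1)
  have hcert : PolyComputable Γ.extend fun p =>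
      Refutation.certificate (n p.1) k (b p.1) (fun a => Γ.mem p.1 (2 + a)) p.2 :=
    certificate k hn.weaken hn'.weaken hb.weaken last
  have hsum := sum hbound hbound' hcert
  refine ((hb.sub hn).add hsum).congr fun p => ?_
  rw [Refutation.output]

end PolyComputable

theorem size_getD_le_inputSize (x : List ℕ) (i : ℕ) : (x.getD i 0).size ≤ inputSize x := by
  induction x generalizing i with
  | nil => simp
  | cons a x ih =>
    cases i with
    | zero => simp [inputSize]; omega
    | succ i =>
      have := ih i
      simp only [inputSize, List.map_cons, List.sum_cons, List.getD_cons_succ] at this ⊢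
      omega

theorem length_le_inputSize (x : List ℕ) : x.length ≤ inputSize x := by
  induction x with
  | nil => simp
  | cons a x ih =>
    simp only [inputSize, List.map_cons, List.sum_cons, List.length_cons] at ih ⊢
    omega

/-- The context of a program that is started on the input word of `a`. -/
def inputContext {α : Type} (enc : α → List ℕ) : Context α where
  size a := inputSize (enc a)
  mem a i := (enc a).getD i 0
  size_mem_le _ i := size_getD_le_inputSize _ i
  Var := Empty
  var := nofun
  size_var_le := nofun

/-- The top-level context has no variables, so the subroutine may use base register 0, which is
where the answer is expected. -/
theorem PolyComputable.decidesInPolyTime {α : Type} {enc : α → List ℕ} {f : α → ℕ}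
    (hf : PolyComputable (inputContext enc) f) :
    DecidesInPolyTime enc fun a => decide (f a ≠ 0) := by
  obtain ⟨T, ⟨q, hq⟩, hc⟩ := hf.exists_program
  obtain ⟨c, hc⟩ := hc 0 nofun nofun
  refine ⟨c, q, fun a => ?_⟩
  obtain ⟨t, s', hr, hd, -, -, ht⟩ := hc a (init (enc a)) rfl nofun
  exact ⟨t, s', hr, ht.trans (hq a), by simp [hd]⟩

end RAM

/-! ### The algorithm on hypergraphs -/

open Classical in
/-- The entries of the adjacency tensor. -/
noncomputable def UniformHypergraph.tensor {n k : ℕ} (H : UniformHypergraph n k) (j : ℕ) : ℕ :=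
  if h : j < n ^ k then
    if ∃ e ∈ H, (e : Finset (Fin n)) = Finset.univ.image (finFunctionFinEquiv.symm ⟨j, h⟩)
    then 1 else 0
  else 0

theorem UniformHypergraph.encode_getD {n k : ℕ} (H : UniformHypergraph n k) (b j : ℕ) :
    (H.encode b).getD (2 + j) 0 = H.tensor j := by
  rw [UniformHypergraph.encode, add_comm, List.getD_cons_succ, List.getD_cons_succ,
    UniformHypergraph.tensor]
  split_ifs with h h' <;> simp [List.getD_eq_getElem?_getD, h]
  · simpa using h'
  · simpa using h'

namespace Refutation

/-- The refutation algorithm. -/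
noncomputable def refute (k n : ℕ) (H : UniformHypergraph n k) (b : ℕ) : Bool :=
  decide (output n k b H.tensor ≠ 0)

theorem refute_decidesInPolyTime {k : ℕ} (hk : k ≠ 0) :
    RAM.DecidesInPolyTime
      (fun x : (n : ℕ) × UniformHypergraph n k × ℕ => UniformHypergraph.encode x.2.1 x.2.2)
      (fun x => refute k x.1 x.2.1 x.2.2) := by
  let Γ := RAM.inputContext
    (fun x : (n : ℕ) × UniformHypergraph n k × ℕ => UniformHypergraph.encode x.2.1 x.2.2)
  have hn : RAM.PolyComputable Γ fun x => x.1 := (RAM.PolyComputable.const 0).load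
  have hb : RAM.PolyComputable Γ fun x => x.2.2 := (RAM.PolyComputable.const 1).load
  -- The word lists all n^k ≥ n tensor entries, so n is bounded in value by the input size. For b
  -- only the binary length is bounded, and no loop runs up to b.
  have hn' : RAM.PolyBounded Γ fun x => x.1 := by
    refine RAM.PolyBounded.size.mono fun x => ?_
    refine le_trans ?_ (RAM.length_le_inputSize _)
    simp only [UniformHypergraph.encode, List.length_cons, List.length_ofFn]
    have := Nat.le_self_pow hk x.1
    omega
  have h := (RAM.PolyComputable.output k hn hn' hb).decidesInPolyTime
  convert h using 2 with x
  rw [refute]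
  congr 3
  funext a
  exact (UniformHypergraph.encode_getD _ _ _).symm

end Refutation

namespace Refutation

/-! ## The refutation matrix -/

/-- The index set of the refutation matrix: `(k - 1)`-tuples, split into two parts. -/
abbrev Row (n k : ℕ) : Type := (Fin (k / 2) → Fin n) × (Fin (k - 1 - k / 2) → Fin n)

/-- The vertex set that consists of the first part of `u`, the second part of `v` and `i`. -/
def edge {n k : ℕ} (u v : Row n k) (i : Fin n) : Finset (Fin n) :=
  Finset.univ.image u.1 ∪ Finset.univ.image v.2 ∪ {i}

/-- The refutation matrix of a weight function on vertex sets. -/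
def refMatrix {n k : ℕ} {R : Type} [CommRing R] (w : Finset (Fin n) → R) :
    Matrix (Row n k) (Row n k) R :=
  fun u v => ∑ i, if edge u v i = edge v u i then 0 else w (edge u v i) * w (edge v u i)

open Classical in
/-- The weight function of a hypergraph: `D - j` on hyperedges, and `-j` on the other `k`-sets. -/
noncomputable def weight {n k : ℕ} {R : Type} [CommRing R] (H : UniformHypergraph n k) (D j : R)
    (e : Finset (Fin n)) : R :=
  if h : e.card = k then (if ⟨e, h⟩ ∈ H then D else 0) - j else 0

theorem refMatrix_comm {n k : ℕ} {R : Type} [CommRing R] (w : Finset (Fin n) → R)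
    (u v : Row n k) : refMatrix w u v = refMatrix w v u := by
  refine Finset.sum_congr rfl fun i _ => ?_
  simp only [eq_comm (a := edge v u i), mul_comm (w (edge v u i))]

theorem refMatrix_transpose {n k : ℕ} {R : Type} [CommRing R] (w : Finset (Fin n) → R) :
    (refMatrix w : Matrix (Row n k) (Row n k) R).transpose = refMatrix w :=
  Matrix.ext fun u v => refMatrix_comm w v u

/-- For symmetric B this is the squared Frobenius norm of B^l. It makes the trace nonnegative and
comparable with quadratic forms. -/
theorem trace_even_pow {m R : Type} [Fintype m] [DecidableEq m] [CommRing R] {B : Matrix m m R}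
    (hB : B.transpose = B) (l : ℕ) : (B ^ (2 * l)).trace = ∑ u, ∑ v, (B ^ l) u v ^ 2 := by
  have hl : (B ^ l).transpose = B ^ l := by rw [Matrix.transpose_pow, hB]
  rw [two_mul, pow_add, Matrix.trace]
  refine Finset.sum_congr rfl fun u _ => ?_
  rw [Matrix.diag_apply, Matrix.mul_apply]
  refine Finset.sum_congr rfl fun v _ => ?_
  rw [sq, show (B ^ l) v u = (B ^ l).transpose u v from rfl, hl]

theorem abs_pow_apply_le {m : Type} [Fintype m] [DecidableEq m] {B : Matrix m m ℤ} {c : ℤ}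
    (hB : ∀ u v, |B u v| ≤ c) (l : ℕ) (u v : m) :
    |(B ^ (l + 1)) u v| ≤ (Fintype.card m : ℤ) ^ l * c ^ (l + 1) := by
  have hc : 0 ≤ c := (abs_nonneg _).trans (hB u v)
  induction l generalizing u v with
  | zero => simpa using hB u v
  | succ l ih =>
    rw [pow_succ, Matrix.mul_apply]
    calc |∑ w, (B ^ (l + 1)) u w * B w v| ≤ ∑ w, |(B ^ (l + 1)) u w * B w v| :=
          Finset.abs_sum_le_sum_abs _ _
      _ ≤ ∑ _w : m, (Fintype.card m : ℤ) ^ l * c ^ (l + 1) * c := by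
          refine Finset.sum_le_sum fun w _ => ?_
          rw [abs_mul]
          exact mul_le_mul (ih u w) (hB w v) (abs_nonneg _) (by positivity)
      _ = _ := by
          rw [Finset.sum_const, Finset.card_univ, nsmul_eq_mul]
          ring

/-- A crude bound suffices: it only has to show that the modulus exceeds the trace. -/
theorem trace_pow_le {m : Type} [Fintype m] [DecidableEq m] {B : Matrix m m ℤ} {c : ℤ}
    (hB : ∀ u v, |B u v| ≤ c) {l : ℕ} (hl : l ≠ 0) :
    (B ^ l).trace ≤ ((Fintype.card m : ℤ) * c) ^ l := by
  obtain ⟨l, rfl⟩ := Nat.exists_eq_succ_of_ne_zero hl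
  calc (B ^ (l + 1)).trace ≤ ∑ _u : m, (Fintype.card m : ℤ) ^ l * c ^ (l + 1) :=
        Finset.sum_le_sum fun u _ => (le_abs_self _).trans (abs_pow_apply_le hB l u u)
    _ = _ := by
        rw [Finset.sum_const, Finset.card_univ, nsmul_eq_mul, Nat.succ_eq_add_one]
        ring

theorem abs_weight_le {n k : ℕ} (H : UniformHypergraph n k) {D j : ℤ} (hj : 0 ≤ j) (hjD : j ≤ D)
    (e : Finset (Fin n)) : |weight H D j e| ≤ D := by
  rw [weight, abs_le]
  split_ifs <;> constructor <;> omega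

theorem abs_refMatrix_le {n k : ℕ} {w : Finset (Fin n) → ℤ} {D : ℤ} (hw : ∀ e, |w e| ≤ D)
    (u v : Row n k) : |refMatrix w u v| ≤ n * D ^ 2 := by
  have hD : 0 ≤ D := (abs_nonneg _).trans (hw ∅)
  calc |refMatrix w u v| ≤ ∑ i, |if edge u v i = edge v u i then 0
          else w (edge u v i) * w (edge v u i)| := Finset.abs_sum_le_sum_abs _ _
    _ ≤ ∑ _i : Fin n, D ^ 2 := by
        refine Finset.sum_le_sum fun i _ => ?_
        split_ifs
        · simpa using sq_nonneg D
        · rw [abs_mul, sq]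
          exact mul_le_mul (hw _) (hw _) (abs_nonneg _) hD
    _ = _ := by simp

/-! ## Codes of tuples -/

/-- The set of the first `k` digits of `x`. -/
def digitSet (n k x : ℕ) : Finset ℕ := (Finset.range k).image (digit n x)

theorem eqInd_eq (x y : ℕ) : eqInd x y = if x = y then 1 else 0 := by
  rw [eqInd]
  split_ifs <;> omega

theorem coincidences_eq (n k x y : ℕ) :
    coincidences n k x y = ∑ c ∈ Finset.range k,
      ((Finset.range k).filter fun c' => digit n x c = digit n y c').card := by
  simp only [coincidences, eqInd_eq, Finset.card_filter]

/-- Every position coincides with itself, so there are always at least k coincidences, and exactly k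
when the digit map is injective. -/
theorem distinctInd_eq (n k x : ℕ) :
    distinctInd n k x = if (digitSet n k x).card = k then 1 else 0 := by
  have hle : ∀ c ∈ Finset.range k,
      1 ≤ ((Finset.range k).filter fun c' => digit n x c = digit n x c').card := fun c hc =>
    Finset.card_pos.2 ⟨c, by simpa using hc⟩
  have hk : k ≤ coincidences n k x x := by
    rw [coincidences_eq]
    simpa using Finset.sum_le_sum hle
  have hiff : (digitSet n k x).card = k ↔ coincidences n k x x = k := by
    have h1 : (digitSet n k x).card = k ↔ Set.InjOn (digit n x) (Finset.range k) := by
      rw [← Finset.card_image_iff, Finset.card_range, digitSet]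
    rw [h1, coincidences_eq]
    have h2 : (∑ c ∈ Finset.range k, 1 = ∑ c ∈ Finset.range k,
        ((Finset.range k).filter fun c' => digit n x c = digit n x c').card) ↔ _ :=
      Finset.sum_eq_sum_iff_of_le hle
    rw [eq_comm, show k = ∑ c ∈ Finset.range k, 1 by simp] at *
    simp only [Finset.sum_const, Finset.card_range, smul_eq_mul, mul_one] at h2 ⊢
    rw [eq_comm, h2]
    constructor
    · intro h c hc
      rw [eq_comm, Finset.card_eq_one]
      refine ⟨c, Finset.eq_singleton_iff_unique_mem.2 ⟨by simpa using hc, fun c' hc' => ?_⟩⟩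
      rw [Finset.mem_filter] at hc'
      exact (h (by exact_mod_cast hc) (by exact_mod_cast hc'.1) hc'.2).symm
    · intro h c hc c' hc' e
      have hc1 : c ∈ Finset.range k := by exact_mod_cast hc
      have hc2 : c' ∈ Finset.range k := by exact_mod_cast hc'
      exact Finset.card_le_one.1 (h c hc1).ge _ (Finset.mem_filter.2 ⟨hc1, rfl⟩) _
        (Finset.mem_filter.2 ⟨hc2, e⟩)
  rw [distinctInd]
  split_ifs with h
  · rw [hiff] at h; omega
  · rw [hiff] at h; omega

/-- With distinct digits on both sides, each digit of x matches at most one position of y, so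
coincidences count common elements. The value k then means equality of the two k-sets. -/
theorem coincidences_eq_card_inter {n k x y : ℕ} (hx : (digitSet n k x).card = k)
    (hy : (digitSet n k y).card = k) :
    coincidences n k x y = (digitSet n k x ∩ digitSet n k y).card := by
  have hx' : Set.InjOn (digit n x) (Finset.range k) := by
    rw [← Finset.card_image_iff, Finset.card_range]; exact hx
  have hy' : Set.InjOn (digit n y) (Finset.range k) := by
    rw [← Finset.card_image_iff, Finset.card_range]; exact hy
  have h : ∀ c ∈ Finset.range k,
      ((Finset.range k).filter fun c' => digit n x c = digit n y c').card =
        if digit n x c ∈ digitSet n k y then 1 else 0 := by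
    intro c hc
    split_ifs with h
    · obtain ⟨c', hc', e⟩ := Finset.mem_image.1 h
      rw [Finset.card_eq_one]
      refine ⟨c', Finset.eq_singleton_iff_unique_mem.2 ⟨by simpa [e] using hc', fun d hd => ?_⟩⟩
      rw [Finset.mem_filter] at hd
      exact hy' (by exact_mod_cast hd.1) (by exact_mod_cast hc') (hd.2.symm.trans e.symm)
    · rw [Finset.card_eq_zero, Finset.filter_eq_empty_iff]
      intro c' hc' e
      exact h (Finset.mem_image.2 ⟨c', hc', e.symm⟩)
  rw [coincidences_eq, Finset.sum_congr rfl h, ← Finset.card_filter, digitSet, digitSet,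
    ← Finset.filter_mem_eq_inter, Finset.filter_image,
    Finset.card_image_of_injOn (hx'.mono fun c hc => by
      simp only [Finset.coe_filter, Set.mem_ofPred_eq] at hc
      exact_mod_cast hc.1)]

theorem maskInd_eq (n k x y : ℕ) :
    maskInd n k x y = if (digitSet n k x).card = k ∧ (digitSet n k y).card = k ∧
      digitSet n k x ≠ digitSet n k y then 1 else 0 := by
  rw [maskInd, distinctInd_eq, distinctInd_eq]
  by_cases hx : (digitSet n k x).card = k
  · by_cases hy : (digitSet n k y).card = k
    · rw [coincidences_eq_card_inter hx hy]
      by_cases h : digitSet n k x = digitSet n k y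
      · simp [h, hy]
      · have hlt : (digitSet n k x ∩ digitSet n k y).card < k := by
          refine lt_of_le_of_ne ((Finset.card_le_card Finset.inter_subset_left).trans hx.le) ?_
          intro hc
          have h1 := Finset.eq_of_subset_of_card_le
            (Finset.inter_subset_left (s₁ := digitSet n k x) (s₂ := digitSet n k y)) (by omega)
          have h2 := Finset.eq_of_subset_of_card_le
            (Finset.inter_subset_right (s₁ := digitSet n k x) (s₂ := digitSet n k y)) (by omega)
          exact h (h1.symm.trans h2)
        simp only [hx, hy, h, ne_eq, not_false_eq_true, and_self, if_true]
        omega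
    · simp [hy]
  · simp [hx]

theorem digitSet_add {n m l x y : ℕ} (hx : x < n ^ m) :
    digitSet n (m + l) (x + n ^ m * y) = digitSet n m x ∪ digitSet n l y := by
  have hn : 0 < n ^ m := by omega
  rw [digitSet, Finset.range_add_eq_union, Finset.image_union]
  congr 1
  · refine Finset.image_congr fun c hc => ?_
    simp only [Finset.coe_range, Set.mem_Iio] at hc
    obtain ⟨e, rfl⟩ := Nat.exists_eq_add_of_lt hc
    have hc0 : 0 < n ^ c := by
      rw [pow_add, pow_add] at hn
      exact Nat.pos_of_mul_pos_right (Nat.pos_of_mul_pos_right hn)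
    rw [digit, digit, show n ^ (c + e + 1) * y = n ^ c * (n * (n ^ e * y)) by ring,
      Nat.add_mul_div_left _ _ hc0, Nat.add_mul_mod_self_left]
  · rw [Finset.map_eq_image, Finset.image_image, digitSet]
    refine Finset.image_congr fun c _ => ?_
    simp only [Function.comp_apply, digit, addLeftEmbedding_apply]
    rw [pow_add, ← Nat.div_div_eq_div_mul, Nat.add_mul_div_left _ _ hn, Nat.div_eq_of_lt hx,
      zero_add]

theorem digitSet_eq_image {n m x : ℕ} (hx : x < n ^ m) :
    digitSet n m x =
      (Finset.univ.image (finFunctionFinEquiv.symm (⟨x, hx⟩ : Fin (n ^ m)))).image Fin.val := by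
  ext y
  simp only [digitSet, Finset.mem_image, Finset.mem_range, Finset.mem_univ, true_and,
    exists_exists_eq_and]
  constructor
  · rintro ⟨c, hc, rfl⟩
    exact ⟨⟨c, hc⟩, rfl⟩
  · rintro ⟨c, rfl⟩
    exact ⟨c, c.2, rfl⟩

theorem digitSet_finFunctionFinEquiv {n m : ℕ} (f : Fin m → Fin n) :
    digitSet n m (finFunctionFinEquiv f : ℕ) = (Finset.univ.image f).image Fin.val := by
  rw [digitSet_eq_image (finFunctionFinEquiv f).2, Fin.eta, Equiv.symm_apply_apply]

theorem half_add_half {k : ℕ} (_ : k ≠ 0) : k - 1 - k / 2 + k / 2 = k - 1 := by omega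

/-- The numbering of the rows of the refutation matrix. -/
def rowEquiv (n : ℕ) {k : ℕ} (hk : k ≠ 0) : Row n k ≃ Fin (n ^ (k - 1)) :=
  ((Equiv.prodCongr finFunctionFinEquiv finFunctionFinEquiv).trans
    ((Equiv.prodComm _ _).trans finProdFinEquiv)).trans
      (finCongr (by rw [← pow_add, half_add_half hk]))

theorem rowEquiv_apply {n k : ℕ} (hk : k ≠ 0) (u : Row n k) :
    (rowEquiv n hk u : ℕ) =
      (finFunctionFinEquiv u.1 : ℕ) + n ^ (k / 2) * (finFunctionFinEquiv u.2 : ℕ) := by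
  simp [rowEquiv]

theorem tupleCode_rowEquiv {n k : ℕ} (hk : k ≠ 0) (u v : Row n k) (i : Fin n) :
    tupleCode n k (rowEquiv n hk u) (rowEquiv n hk v) i = (finFunctionFinEquiv u.1 : ℕ) +
      n ^ (k / 2) * (finFunctionFinEquiv v.2 : ℕ) + n ^ (k - 1) * i := by
  have hn : 0 < n := i.pos
  rw [tupleCode, rowEquiv_apply, rowEquiv_apply, Nat.add_mul_mod_self_left,
    Nat.mod_eq_of_lt (finFunctionFinEquiv u.1).2, Nat.add_mul_div_left _ _ (pow_pos hn _),
    Nat.div_eq_of_lt (finFunctionFinEquiv v.1).2]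
  ring

theorem add_mul_lt_pow {n m l x y : ℕ} (hx : x < n ^ m) (hy : y < n ^ l) :
    x + n ^ m * y < n ^ (m + l) := by
  rw [pow_add]
  calc x + n ^ m * y < n ^ m * (y + 1) := by rw [mul_add]; omega
    _ ≤ n ^ m * n ^ l := Nat.mul_le_mul_left _ hy

theorem tupleCode_lt {n k : ℕ} (hk : k ≠ 0) (u v : Row n k) (i : Fin n) :
    tupleCode n k (rowEquiv n hk u) (rowEquiv n hk v) i < n ^ k := by
  have h := add_mul_lt_pow (add_mul_lt_pow (finFunctionFinEquiv u.1).2 (finFunctionFinEquiv v.2).2)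
    (l := 1) (y := (i : ℕ)) (by simp)
  rw [add_comm (k / 2), half_add_half hk, Nat.sub_add_cancel (Nat.pos_of_ne_zero hk)] at h
  rwa [tupleCode_rowEquiv]

theorem digitSet_tupleCode {n k : ℕ} (hk : k ≠ 0) (u v : Row n k) (i : Fin n) :
    digitSet n k (tupleCode n k (rowEquiv n hk u) (rowEquiv n hk v) i) =
      (edge u v i).image Fin.val := by
  have h1 := digitSet_add (l := k - 1 - k / 2) (y := (finFunctionFinEquiv v.2 : ℕ))
    (finFunctionFinEquiv u.1).2
  have h2 := digitSet_add (l := 1) (y := (i : ℕ)) (add_mul_lt_pow (finFunctionFinEquiv u.1).2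
    (finFunctionFinEquiv v.2).2)
  rw [add_comm (k / 2), half_add_half hk] at h1 h2
  rw [Nat.sub_add_cancel (Nat.pos_of_ne_zero hk)] at h2
  rw [tupleCode_rowEquiv, h2, h1, digitSet_finFunctionFinEquiv, digitSet_finFunctionFinEquiv, edge,
    Finset.image_union, Finset.image_union]
  congr 1
  simp [digitSet, digit, Nat.mod_eq_of_lt i.2]

theorem tensor_eq {n k : ℕ} (H : UniformHypergraph n k) {x : ℕ} (hx : x < n ^ k)
    {e : Finset (Fin n)} (he : digitSet n k x = e.image Fin.val) (D j : ℤ) (hk : e.card = k) :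
    D * H.tensor x - j = weight H D j e := by
  rw [digitSet_eq_image hx] at he
  have he' := Finset.image_injective Fin.val_injective he
  rw [UniformHypergraph.tensor, dif_pos hx, weight, dif_pos hk, he']
  have : (∃ e' ∈ H, (e' : Finset (Fin n)) = e) ↔ ⟨e, hk⟩ ∈ H := by
    constructor
    · rintro ⟨e', h1, rfl⟩; exact h1
    · exact fun h => ⟨_, h, rfl⟩
  by_cases h : (⟨e, hk⟩ : {e : Finset (Fin n) // e.card = k}) ∈ H
  · rw [if_pos (this.2 h), if_pos h]; simp
  · rw [if_neg (mt this.1 h), if_neg h]; simp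

/-! ## The algorithm computes the trace of a power of the refutation matrix -/

/-- Modulo Q, adding Q - j is subtracting j. The numerical mask also drops tuples with repeated
vertices; in `refMatrix` these disappear because `weight` vanishes off k-sets. -/
theorem entryCode_cast {n k : ℕ} (hk : k ≠ 0) (H : UniformHypergraph n k) {Q j : ℕ} (hj : j ≤ Q)
    (u v : Row n k) :
    (entryCode n k Q j H.tensor (rowEquiv n hk u) (rowEquiv n hk v) : ZMod Q) =
      ((refMatrix (weight H ((4 * n ^ k : ℕ) : ℤ) j) u v : ℤ) : ZMod Q) := by
  have hcent : ∀ (u v : Row n k) (i : Fin n), (edge u v i).card = k →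
      (centered n k Q j (H.tensor (tupleCode n k (rowEquiv n hk u) (rowEquiv n hk v) i)) : ZMod Q) =
        ((weight H ((4 * n ^ k : ℕ) : ℤ) j (edge u v i) : ℤ) : ZMod Q) := by
    intro u v i he
    rw [← tensor_eq H (tupleCode_lt hk u v i) (digitSet_tupleCode hk u v i) _ _ he, centered]
    push_cast [hj]
    simp [sub_eq_add_neg]
  rw [entryCode, refMatrix, Finset.sum_range]
  simp only [Nat.cast_sum, Nat.cast_mul, Int.cast_sum, Int.cast_ite, Int.cast_zero, Int.cast_mul]
  refine Finset.sum_congr rfl fun i _ => ?_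
  rw [maskInd_eq, digitSet_tupleCode, digitSet_tupleCode,
    Finset.card_image_of_injective _ Fin.val_injective,
    Finset.card_image_of_injective _ Fin.val_injective]
  simp only [ne_eq, (Finset.image_injective Fin.val_injective).eq_iff]
  by_cases h1 : (edge u v i).card = k
  · by_cases h2 : (edge v u i).card = k
    · by_cases h3 : edge u v i = edge v u i
      · simp [h3]
      · simp [h1, h2, h3, hcent]
    · simp [h2, weight]
  · simp [h1, weight]

theorem sum_range_rowEquiv {n k : ℕ} (hk : k ≠ 0) {M : Type} [AddCommMonoid M] (f : ℕ → M) :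
    ∑ m ∈ Finset.range (n ^ (k - 1)), f m = ∑ u : Row n k, f (rowEquiv n hk u) := by
  rw [Finset.sum_range, ← (rowEquiv n hk).sum_comp]

theorem mul_add_lt_mul {N a b : ℕ} (ha : a < N) (hb : b < N) : a * N + b < N * N := by nlinarith

theorem powCode_cast {n k : ℕ} (hk : k ≠ 0) (H : UniformHypergraph n k) {Q j : ℕ} (hQ : 0 < Q)
    (hj : j ≤ Q) (i : ℕ) (u v : Row n k) :
    (digit Q (powCode (n ^ (k - 1)) Q (matrixCode n k Q j H.tensor) i)
      (rowEquiv n hk u * n ^ (k - 1) + rowEquiv n hk v) : ZMod Q) =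
      (((refMatrix (weight H ((4 * n ^ k : ℕ) : ℤ) j) ^ 2 ^ i :
        Matrix (Row n k) (Row n k) ℤ) u v : ℤ) : ZMod Q) := by
  induction i generalizing u v with
  | zero =>
    have hv := (rowEquiv n hk v).2
    have hN : 0 < n ^ (k - 1) := by omega
    rw [powCode, matrixCode, digit_sum_mul_pow (fun w => _ % Q) _ _
      (mul_add_lt_mul (rowEquiv n hk u).2 hv) fun _ _ => Nat.mod_lt _ hQ, ZMod.natCast_mod,
      mul_comm, Nat.mul_add_div hN, Nat.mul_add_mod, Nat.div_eq_of_lt hv, Nat.mod_eq_of_lt hv,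
      add_zero, entryCode_cast hk H hj, pow_zero, pow_one]
  | succ i ih =>
    have hv := (rowEquiv n hk v).2
    have hN : 0 < n ^ (k - 1) := by omega
    rw [powCode, squareCode, digit_sum_mul_pow (fun w => _ % Q) _ _
      (mul_add_lt_mul (rowEquiv n hk u).2 hv) fun _ _ => Nat.mod_lt _ hQ, ZMod.natCast_mod,
      mul_comm (rowEquiv n hk u : ℕ), Nat.mul_add_div hN, Nat.mul_add_mod, Nat.div_eq_of_lt hv,
      Nat.mod_eq_of_lt hv, add_zero, sum_range_rowEquiv hk, pow_succ, pow_mul, sq,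
      Matrix.mul_apply]
    simp only [Nat.cast_sum, Nat.cast_mul, Int.cast_sum, Int.cast_mul, ih]

/-- The trace lies in [0, Q), so its residue modulo Q determines it. Nonnegativity uses that the
exponent is even, which the extra squaring in `squarings` guarantees. -/
theorem traceCode_eq {n k : ℕ} (hk : k ≠ 0) (H : UniformHypergraph n k) {j : ℕ}
    (hj : j ≤ 4 * n ^ k) :
    ((traceCode (n ^ (k - 1)) (modulus n k) (powCode (n ^ (k - 1)) (modulus n k)
      (matrixCode n k (modulus n k) j H.tensor) (squarings n)) : ℕ) : ℤ) =
      (refMatrix (weight H ((4 * n ^ k : ℕ) : ℤ) j) ^ 2 ^ squarings n :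
        Matrix (Row n k) (Row n k) ℤ).trace := by
  set B : Matrix (Row n k) (Row n k) ℤ := refMatrix (weight H ((4 * n ^ k : ℕ) : ℤ) j)
  have hQ : 0 < modulus n k := Nat.succ_pos _
  have hjQ : j ≤ modulus n k := by rw [modulus]; omega
  have h0 : 0 ≤ (B ^ 2 ^ squarings n).trace := by
    rw [squarings, pow_succ' 2, trace_even_pow (refMatrix_transpose _)]
    positivity
  have h1 : (B ^ 2 ^ squarings n).trace < modulus n k := by
    have hle := trace_pow_le (abs_refMatrix_le (n := n) (k := k)
      (abs_weight_le H (D := ((4 * n ^ k : ℕ) : ℤ)) (Int.natCast_nonneg j)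
        (by exact_mod_cast hj))) (l := 2 ^ squarings n)
      (by positivity)
    refine hle.trans_lt ?_
    have hcard : Fintype.card (Row n k) = n ^ (k - 1) := by
      rw [Fintype.card_congr (rowEquiv n hk), Fintype.card_fin]
    obtain ⟨k, rfl⟩ := Nat.exists_eq_succ_of_ne_zero hk
    -- Dimension times entry bound is n^(k-1)·n·(4n^k)² = 16·n^(3k), the base of the power in
    -- `modulus`.
    have : (Fintype.card (Row n (k + 1)) : ℤ) * (n * ((4 * n ^ (k + 1) : ℕ) : ℤ) ^ 2) =
        ((16 * n ^ (3 * (k + 1)) : ℕ) : ℤ) := by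
      rw [hcard]
      push_cast
      ring
    rw [this, modulus]
    push_cast
    have : (0 : ℤ) ≤ n ^ (k + 1) := by positivity
    simp only [Nat.succ_eq_add_one]
    omega
  have h2 : ((traceCode (n ^ (k - 1)) (modulus n k) (powCode (n ^ (k - 1)) (modulus n k)
      (matrixCode n k (modulus n k) j H.tensor) (squarings n)) : ℕ) : ZMod (modulus n k)) =
      (((B ^ 2 ^ squarings n).trace : ℤ) : ZMod (modulus n k)) := by
    rw [traceCode, ZMod.natCast_mod, sum_range_rowEquiv hk, Matrix.trace]
    push_cast
    refine Finset.sum_congr rfl fun u _ => ?_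
    rw [powCode_cast hk H hQ hjQ, Matrix.diag_apply]
  have h3 := (ZMod.intCast_eq_intCast_iff' _ _ _).1
    (show (((_ : ℕ) : ℤ) : ZMod (modulus n k)) = _ from (Int.cast_natCast _).trans h2)
  rwa [Int.emod_eq_of_lt h0 h1, Int.emod_eq_of_lt (Int.natCast_nonneg _)
    (by exact_mod_cast Nat.mod_lt _ hQ)] at h3

/-- The condition under which the algorithm refutes independent sets of size `b ≤ n`. -/
theorem refute_iff {n k : ℕ} (hk : k ≠ 0) (H : UniformHypergraph n k) (b : ℕ) :
    refute k n H b = true ↔ n < b ∨ ∃ j ≤ 4 * n ^ k,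
      (refMatrix (weight H ((4 * n ^ k : ℕ) : ℤ) j) ^ 2 ^ squarings n :
        Matrix (Row n k) (Row n k) ℤ).trace * (b ^ (k - 1)) ^ 2 ^ squarings n <
      (formBound n k b j (∑ x ∈ Finset.range (n ^ k), H.tensor x) : ℤ) ^ 2 ^ squarings n := by
  have hcert : ∀ j ≤ 4 * n ^ k, (certificate n k b H.tensor j ≠ 0 ↔
      (refMatrix (weight H ((4 * n ^ k : ℕ) : ℤ) j) ^ 2 ^ squarings n :
        Matrix (Row n k) (Row n k) ℤ).trace * (b ^ (k - 1)) ^ 2 ^ squarings n <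
      (formBound n k b j (∑ x ∈ Finset.range (n ^ k), H.tensor x) : ℤ) ^ 2 ^ squarings n) := by
    intro j hj
    rw [certificate, Nat.sub_ne_zero_iff_lt, ← Nat.cast_lt (α := ℤ), Nat.cast_mul,
      traceCode_eq hk H hj, Nat.cast_pow, Nat.cast_pow, Nat.cast_pow]
  rw [refute, decide_eq_true_iff, output, ne_eq, Nat.add_eq_zero_iff, not_and_or,
    ← ne_eq, Nat.sub_ne_zero_iff_lt, Finset.sum_eq_zero_iff]
  push Not
  refine or_congr_right (exists_congr fun j => ?_)
  rw [Finset.mem_range, Nat.lt_succ_iff]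
  exact and_congr_right fun hj => hcert j hj

end Refutation

namespace Refutation

/-! ## The algorithm never errs -/

section QuadraticForm

variable {m : Type} [Fintype m] [DecidableEq m]

/-- This is ⟨1_P, B²1_P⟩ = ‖B·1_P‖² for symmetric B. -/
theorem sum_sum_sq_apply {B : Matrix m m ℤ} (hB : B.transpose = B) (P : Finset m) :
    ∑ u ∈ P, ∑ v ∈ P, (B ^ 2) u v = ∑ w, (∑ u ∈ P, B w u) ^ 2 := by
  have h : ∀ u v, (B ^ 2) u v = ∑ w, B w u * B w v := fun u v => by
    rw [sq, Matrix.mul_apply]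
    refine Finset.sum_congr rfl fun w _ => ?_
    rw [show B w u = B.transpose u w from rfl, hB]
  simp_rw [h, sq, Finset.sum_mul_sum]
  rw [Finset.sum_comm' (s := Finset.univ) (t := fun _ => P) (s' := fun _ => Finset.univ)
    (t' := P) (by simp)]
  exact Finset.sum_congr rfl fun u _ => Finset.sum_comm

/-- Cauchy–Schwarz on the rows in P; the other rows add nonnegative squares to ‖B·1_P‖². -/
theorem sq_sum_sum_le {B : Matrix m m ℤ} (hB : B.transpose = B) (P : Finset m) :
    (∑ u ∈ P, ∑ v ∈ P, B u v) ^ 2 ≤ P.card * ∑ u ∈ P, ∑ v ∈ P, (B ^ 2) u v := by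
  rw [sum_sum_sq_apply hB]
  refine sq_sum_le_card_mul_sum_sq.trans (mul_le_mul_of_nonneg_left ?_ (Int.natCast_nonneg _))
  exact Finset.sum_le_sum_of_subset_of_nonneg (Finset.subset_univ _) fun _ _ _ => sq_nonneg _

/-- Cauchy–Schwarz in each row bounds ‖B·1_P‖² by |P| times the squared Frobenius norm. -/
theorem sum_sum_sq_le_trace {B : Matrix m m ℤ} (hB : B.transpose = B) (P : Finset m) :
    ∑ u ∈ P, ∑ v ∈ P, (B ^ 2) u v ≤ P.card * (B ^ 2).trace := by
  rw [sum_sum_sq_apply hB, show B ^ 2 = B ^ (2 * 1) by rfl, trace_even_pow hB, Finset.mul_sum]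
  refine Finset.sum_le_sum fun w _ => ?_
  rw [pow_one]
  refine sq_sum_le_card_mul_sum_sq.trans (mul_le_mul_of_nonneg_left ?_ (Int.natCast_nonneg _))
  exact Finset.sum_le_sum_of_subset_of_nonneg (Finset.subset_univ _) fun _ _ _ => sq_nonneg _

theorem transpose_pow_of_symm {B : Matrix m m ℤ} (hB : B.transpose = B) (l : ℕ) :
    (B ^ l).transpose = B ^ l := by rw [Matrix.transpose_pow, hB]

/-- Iterated Cauchy–Schwarz: squaring the inequality for B^(2^(J+1)) and applying `sq_sum_sum_le` to
that power doubles the exponent. This replaces a convexity argument on the spectral measure, without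
eigenvalues. -/
theorem sum_sum_pow_le {B : Matrix m m ℤ} (hB : B.transpose = B) (P : Finset m) (J : ℕ) :
    P.card * (∑ u ∈ P, ∑ v ∈ P, B u v) ^ 2 ^ (J + 1) ≤
      (P.card : ℤ) ^ 2 ^ (J + 1) * ∑ u ∈ P, ∑ v ∈ P, (B ^ 2 ^ (J + 1)) u v := by
  have hP : (0 : ℤ) ≤ P.card := Int.natCast_nonneg _
  induction J with
  | zero => simpa [sq (P.card : ℤ), mul_assoc] using mul_le_mul_of_nonneg_left (sq_sum_sum_le hB P) hP
  | succ J ih =>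
    set q := ∑ u ∈ P, ∑ v ∈ P, B u v
    set r := ∑ u ∈ P, ∑ v ∈ P, (B ^ 2 ^ (J + 1)) u v
    have h := sq_sum_sum_le (transpose_pow_of_symm hB (2 ^ (J + 1))) P
    rw [← pow_mul, ← pow_succ] at h
    rcases hP.eq_or_lt with h0 | hpos
    · rw [← h0, zero_mul, zero_pow (by positivity), zero_mul]
    · have hq : 0 ≤ P.card * q ^ 2 ^ (J + 1) := by
        rw [pow_succ' 2, pow_mul]; positivity
      have h2 := pow_le_pow_left₀ hq ih 2
      rw [mul_pow, mul_pow, ← pow_mul, ← pow_mul, ← pow_succ] at h2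
      have h3 := h2.trans (mul_le_mul_of_nonneg_left h (by positivity))
      refine le_of_mul_le_mul_left ?_ hpos
      calc _ = (P.card : ℤ) ^ 2 * q ^ 2 ^ (J + 1 + 1) := by ring
        _ ≤ _ := h3
        _ = _ := by ring

/-- An integer version of ⟨1_P, B·1_P⟩ ≤ |P|·‖B‖ combined with ‖B‖^L ≤ tr B^L for even L. It makes
every certificate valid. -/
theorem sum_sum_pow_le_trace {B : Matrix m m ℤ} (hB : B.transpose = B) (P : Finset m) (J : ℕ) :
    (∑ u ∈ P, ∑ v ∈ P, B u v) ^ 2 ^ (J + 1) ≤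
      (P.card : ℤ) ^ 2 ^ (J + 1) * (B ^ 2 ^ (J + 1)).trace := by
  rcases P.eq_empty_or_nonempty with rfl | hne
  · simp
  · have hpos : (0 : ℤ) < P.card := by exact_mod_cast hne.card_pos
    have h := sum_sum_sq_le_trace (transpose_pow_of_symm hB (2 ^ J)) P
    rw [← pow_mul, ← pow_succ] at h
    refine le_of_mul_le_mul_left ((sum_sum_pow_le hB P J).trans ?_) hpos
    calc _ ≤ (P.card : ℤ) ^ 2 ^ (J + 1) * (P.card * (B ^ 2 ^ (J + 1)).trace) :=
          mul_le_mul_of_nonneg_left h (by positivity)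
      _ = _ := by ring

end QuadraticForm

variable {n k : ℕ}

/-- The rows with all entries in `S`. -/
def rowsIn (k : ℕ) (S : Finset (Fin n)) : Finset (Row n k) :=
  (Fintype.piFinset fun _ => S) ×ˢ (Fintype.piFinset fun _ => S)

theorem mem_rowsIn {S : Finset (Fin n)} {u : Row n k} :
    u ∈ rowsIn k S ↔ (∀ c, u.1 c ∈ S) ∧ ∀ c, u.2 c ∈ S := by
  simp [rowsIn]

theorem card_rowsIn (hk : k ≠ 0) (S : Finset (Fin n)) :
    (rowsIn k S).card = S.card ^ (k - 1) := by
  rw [rowsIn, Finset.card_product, Fintype.card_piFinset_const, Fintype.card_piFinset_const,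
    ← pow_add, add_comm, half_add_half hk]

theorem edge_subset {S : Finset (Fin n)} {u v : Row n k} {i : Fin n} :
    edge u v i ⊆ S ↔ (∀ c, u.1 c ∈ S) ∧ (∀ c, v.2 c ∈ S) ∧ i ∈ S := by
  rw [edge, Finset.union_subset_iff, Finset.union_subset_iff]
  simp [Finset.image_subset_iff, and_assoc]

/-- Exchanging second parts maps (u,v) bijectively to ((u₁,v₂),(v₁,u₂)), and in these coordinates
the double sum is a product of two equal sums. The entries of the matrix are designed for this
identity. -/
theorem sum_sum_mul_eq_sq (S : Finset (Fin n)) (w : Finset (Fin n) → ℤ) (i : Fin n) :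
    ∑ u ∈ rowsIn k S, ∑ v ∈ rowsIn k S, w (edge u v i) * w (edge v u i) =
      (∑ r ∈ rowsIn k S, w (edge r r i)) ^ 2 := by
  simp only [rowsIn, Finset.sum_product]
  rw [sq, Finset.sum_mul_sum]
  refine Finset.sum_congr rfl fun a _ => ?_
  rw [Finset.sum_comm]
  refine Finset.sum_congr rfl fun d _ => ?_
  rw [Finset.sum_mul_sum, Finset.sum_comm]
  rfl

/-- Injective (k-1)-tuples from S without i give k-sets, and their number is a falling factorial of
|S| - 1. -/
theorem pow_le_card_filter {S : Finset (Fin n)} {i : Fin n} (hk : k ≠ 0) (hi : i ∈ S) :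
    (S.card + 1 - k) ^ (k - 1) ≤ ((rowsIn k S).filter fun r => (edge r r i).card = k).card := by
  have hle : k / 2 ≤ k - 1 ∨ k = 1 := by omega
  let r : (Fin (k - 1) ↪ (S.erase i : Finset (Fin n))) → Row n k := fun φ =>
    (fun c => φ ⟨c, by omega⟩, fun c => φ ⟨k / 2 + c, by omega⟩)
  have hcard : Fintype.card (Fin (k - 1) ↪ (S.erase i : Finset (Fin n))) =
      (S.card - 1).descFactorial (k - 1) := by
    rw [Fintype.card_embedding_eq, Fintype.card_fin, Fintype.card_coe, Finset.card_erase_of_mem hi]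
  have h1 : (S.card + 1 - k) ^ (k - 1) ≤ (S.card - 1).descFactorial (k - 1) := by
    refine le_trans (Nat.pow_le_pow_left ?_ _) (Nat.pow_sub_le_descFactorial _ _)
    omega
  refine h1.trans ?_
  rw [← hcard, ← Finset.card_univ]
  refine Finset.card_le_card_of_injOn r (fun φ _ => ?_) fun φ _ ψ _ h => ?_
  · have hmem : ∀ c, (φ c : Fin n) ∈ S := fun c => Finset.mem_of_mem_erase (φ c).2
    simp only [Finset.coe_filter, Set.mem_ofPred_eq, mem_rowsIn]
    refine ⟨⟨fun c => hmem _, fun c => hmem _⟩, ?_⟩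
    have himg : Finset.univ.image (r φ).1 ∪ Finset.univ.image (r φ).2 =
        Finset.univ.image fun c => (φ c : Fin n) := by
      ext y
      simp only [Finset.mem_union, Finset.mem_image, Finset.mem_univ, true_and]
      constructor
      · rintro (⟨c, rfl⟩ | ⟨c, rfl⟩)
        · exact ⟨_, rfl⟩
        · exact ⟨_, rfl⟩
      · rintro ⟨c, rfl⟩
        rcases lt_or_ge (c : ℕ) (k / 2) with hc | hc
        · exact .inl ⟨⟨c, hc⟩, rfl⟩
        · refine .inr ⟨⟨c - k / 2, by omega⟩, ?_⟩
          simp only [r]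
          congr 2
          ext
          simp only
          omega
    rw [edge, himg, Finset.card_union_of_disjoint, Finset.card_image_of_injective,
      Finset.card_univ, Fintype.card_fin, Finset.card_singleton]
    · omega
    · exact Subtype.val_injective.comp φ.injective
    · simp only [Finset.disjoint_singleton_right, Finset.mem_image, Finset.mem_univ, true_and,
        not_exists]
      exact fun c hc => Finset.ne_of_mem_erase (φ c).2 hc
  · ext c
    have h1 := congrArg Prod.fst h
    have h2 := congrArg Prod.snd h
    rcases lt_or_ge (c : ℕ) (k / 2) with hc | hc
    · exact congrArg Fin.val (congrFun h1 ⟨c, hc⟩)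
    · have h3 := congrArg Fin.val (congrFun h2 ⟨c - k / 2, by omega⟩)
      simp only [r] at h3
      have h4 : (⟨k / 2 + (c - k / 2), by omega⟩ : Fin (k - 1)) = c := by
        ext; simp only; omega
      rwa [h4] at h3

/-- No k-set inside an independent S is a hyperedge, so for i in S the inner sum has no
cancellation: it is -j times the number of rows that form a k-set with i. -/
theorem le_sum_sq {H : UniformHypergraph n k} {S : Finset (Fin n)} (hk : k ≠ 0)
    (hS : H.IsIndependent S) (D : ℤ) (j : ℕ) :
    (S.card * (j * (S.card + 1 - k : ℕ) ^ (k - 1)) ^ 2 : ℤ) ≤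
      ∑ i, (∑ r ∈ rowsIn k S, weight H D (j : ℤ) (edge r r i)) ^ 2 := by
  have h : ∀ i ∈ S, ((j * (S.card + 1 - k : ℕ) ^ (k - 1)) ^ 2 : ℤ) ≤
      (∑ r ∈ rowsIn k S, weight H D (j : ℤ) (edge r r i)) ^ 2 := by
    intro i hi
    have hw : ∀ r ∈ rowsIn k S, weight H D (j : ℤ) (edge r r i) =
        -(j * if (edge r r i).card = k then 1 else 0) := by
      intro r hr
      rw [mem_rowsIn] at hr
      rw [weight]
      split_ifs with h1 h2
      · exact absurd (edge_subset.2 ⟨hr.1, hr.2, hi⟩) (hS _ h2)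
      · ring
      · ring
    rw [Finset.sum_congr rfl hw, Finset.sum_neg_distrib, neg_sq, ← Finset.mul_sum,
      Finset.sum_boole]
    have := pow_le_card_filter hk hi
    gcongr
    exact_mod_cast this
  calc _ = ∑ i ∈ S, ((j * (S.card + 1 - k : ℕ) ^ (k - 1)) ^ 2 : ℤ) := by simp
    _ ≤ _ := Finset.sum_le_sum h
    _ ≤ _ := Finset.sum_le_sum_of_subset_of_nonneg (Finset.subset_univ _) fun _ _ _ => sq_nonneg _

/-- The numbering of the `k`-tuples. -/
def tupleEquiv (n : ℕ) {k : ℕ} (hk : k ≠ 0) : Fin n × Row n k ≃ Fin (n ^ k) :=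
  ((Equiv.prodCongr (Equiv.refl _) (rowEquiv n hk)).trans finProdFinEquiv).trans
    (finCongr (by rw [← pow_succ', Nat.sub_add_cancel (Nat.pos_of_ne_zero hk)]))

theorem tupleEquiv_apply (hk : k ≠ 0) (i : Fin n) (r : Row n k) :
    (tupleEquiv n hk (i, r) : ℕ) =
      tupleCode n k (rowEquiv n hk r) (rowEquiv n hk r) i := by
  rw [tupleCode_rowEquiv, ← rowEquiv_apply hk]
  simp [tupleEquiv]

theorem sum_weight_sq_le (hk : k ≠ 0) (H : UniformHypergraph n k) {D j : ℕ} :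
    ∑ i, ∑ r : Row n k, weight H (D : ℤ) (j : ℤ) (edge r r i) ^ 2 ≤
      D ^ 2 * (∑ x ∈ Finset.range (n ^ k), H.tensor x : ℕ) + j ^ 2 * n ^ k := by
  rw [← Fintype.sum_prod_type' (f := fun i r => weight H (D : ℤ) (j : ℤ) (edge r r i) ^ 2)]
  calc _ ≤ ∑ p : Fin n × Row n k,
        ((D : ℤ) ^ 2 * H.tensor (tupleEquiv n hk p) + (j : ℤ) ^ 2) := by
        refine Finset.sum_le_sum fun p _ => ?_
        by_cases h : (edge p.2 p.2 p.1).card = k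
        · have h1 := tensor_eq H (tupleCode_lt hk p.2 p.2 p.1) (digitSet_tupleCode hk p.2 p.2 p.1)
            (D : ℤ) (j : ℤ) h
          rw [← h1, tupleEquiv_apply]
          -- Dropping the cross term gives (D - j)² ≤ D² + j² at hyperedges.
          have hD : (0 : ℤ) ≤ D * j := by positivity
          have ht : H.tensor (tupleCode n k (rowEquiv n hk p.2) (rowEquiv n hk p.2) p.1) = 0 ∨
              H.tensor (tupleCode n k (rowEquiv n hk p.2) (rowEquiv n hk p.2) p.1) = 1 := by
            rw [UniformHypergraph.tensor]
            split_ifs <;> simp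
          rcases ht with ht | ht <;> rw [ht] <;> push_cast <;> nlinarith
        · rw [weight, dif_neg h]
          positivity
    _ = ∑ x : Fin (n ^ k), ((D : ℤ) ^ 2 * H.tensor x + (j : ℤ) ^ 2) :=
        (tupleEquiv n hk).sum_comp fun x => (D : ℤ) ^ 2 * H.tensor x + (j : ℤ) ^ 2
    _ = _ := by
        rw [Finset.sum_add_distrib, ← Finset.mul_sum, Finset.sum_range]
        simp [mul_comm]

/-- Masked terms are squares, so the sum may be extended to all rows. After the swap of second parts
the mask compares the sets of two rows r and s; if they agree, the entries of s lie in a k-set fixed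
by r and i, which leaves at most k^(k-1) choices. -/
theorem sum_edge_eq_le (hk : k ≠ 0) {w : Finset (Fin n) → ℤ}
    (hw : ∀ e, e.card ≠ k → w e = 0) (P : Finset (Row n k)) (i : Fin n) :
    ∑ u ∈ P, ∑ v ∈ P, (if edge u v i = edge v u i then w (edge u v i) * w (edge v u i) else 0) ≤
      k ^ k * ∑ r : Row n k, w (edge r r i) ^ 2 := by
  have hnonneg : ∀ u v : Row n k,
      0 ≤ if edge u v i = edge v u i then w (edge u v i) * w (edge v u i) else 0 := by
    intro u v
    split_ifs with h
    · rw [← h]; exact mul_self_nonneg _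
    · exact le_rfl
  calc _ ≤ ∑ u : Row n k, ∑ v : Row n k,
        (if edge u v i = edge v u i then w (edge u v i) * w (edge v u i) else 0) :=
        (Finset.sum_le_sum_of_subset_of_nonneg (Finset.subset_univ _) fun u _ _ =>
          Finset.sum_nonneg fun v _ => hnonneg u v).trans
          (Finset.sum_le_sum fun u _ => Finset.sum_le_sum_of_subset_of_nonneg
            (Finset.subset_univ _) fun v _ _ => hnonneg u v)
    _ = ∑ r : Row n k, ∑ s : Row n k,
        (if edge r r i = edge s s i then w (edge r r i) * w (edge s s i) else 0) := by
        simp only [Fintype.sum_prod_type]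
        refine Finset.sum_congr rfl fun a _ => ?_
        rw [Finset.sum_comm]
        conv_rhs => rw [Finset.sum_comm]
        refine Finset.sum_congr rfl fun d _ => ?_
        rw [Finset.sum_comm]
        rfl
    _ ≤ ∑ r : Row n k, (k : ℤ) ^ k * w (edge r r i) ^ 2 := by
        refine Finset.sum_le_sum fun r _ => ?_
        by_cases hr : (edge r r i).card = k
        · calc _ ≤ ∑ s : Row n k, if s ∈ rowsIn k (edge r r i) then w (edge r r i) ^ 2 else 0 := by
                refine Finset.sum_le_sum fun s _ => ?_
                by_cases h : edge r r i = edge s s i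
                · have hs : s ∈ rowsIn k (edge r r i) := by
                    have := edge_subset.1 (h ▸ Finset.Subset.refl (edge s s i) :
                      edge s s i ⊆ edge r r i)
                    exact mem_rowsIn.2 ⟨this.1, this.2.1⟩
                  rw [if_pos h, if_pos hs, ← h, sq]
                · rw [if_neg h]
                  split_ifs <;> positivity
            _ = (k : ℤ) ^ (k - 1) * w (edge r r i) ^ 2 := by
                rw [← Finset.sum_filter, Finset.filter_univ_mem, Finset.sum_const, card_rowsIn hk,
                  hr, nsmul_eq_mul]
                push_cast
                rfl
            _ ≤ _ := by
                refine mul_le_mul_of_nonneg_right ?_ (sq_nonneg _)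
                exact_mod_cast Nat.pow_le_pow_right (Nat.pos_of_ne_zero hk) (Nat.sub_le _ _)
        · rw [hw _ hr]
          simp
    _ = _ := by rw [Finset.mul_sum]

/-- Masked and unmasked terms together form the sum of squares, bounded below by `le_sum_sq`. The
masked part is at most k^k times the total squared weight. -/
theorem formBound_le {H : UniformHypergraph n k} {S : Finset (Fin n)} (hk : k ≠ 0)
    (hS : H.IsIndependent S) (j : ℕ) :
    (S.card * (j * (S.card + 1 - k : ℕ) ^ (k - 1)) ^ 2 - k ^ k * ((4 * n ^ k : ℕ) ^ 2 *
      (∑ x ∈ Finset.range (n ^ k), H.tensor x : ℕ) + j ^ 2 * n ^ k) : ℤ) ≤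
    ∑ u ∈ rowsIn k S, ∑ v ∈ rowsIn k S,
      refMatrix (weight H ((4 * n ^ k : ℕ) : ℤ) (j : ℤ)) u v := by
  set w := weight H ((4 * n ^ k : ℕ) : ℤ) (j : ℤ) with hw_def
  have hw : ∀ e, e.card ≠ k → w e = 0 := fun e he => dif_neg he
  have h1 := le_sum_sq hk hS ((4 * n ^ k : ℕ) : ℤ) j
  have h2 : ∑ i, ∑ u ∈ rowsIn k S, ∑ v ∈ rowsIn k S,
      (if edge u v i = edge v u i then w (edge u v i) * w (edge v u i) else 0) ≤
      k ^ k * ((4 * n ^ k : ℕ) ^ 2 *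
        (∑ x ∈ Finset.range (n ^ k), H.tensor x : ℕ) + j ^ 2 * n ^ k) := by
    refine (Finset.sum_le_sum fun i _ => sum_edge_eq_le hk hw (rowsIn k S) i).trans ?_
    rw [← Finset.mul_sum]
    exact mul_le_mul_of_nonneg_left (sum_weight_sq_le hk H) (by positivity)
  have h3 : ∑ u ∈ rowsIn k S, ∑ v ∈ rowsIn k S, refMatrix w u v +
      ∑ i, ∑ u ∈ rowsIn k S, ∑ v ∈ rowsIn k S,
        (if edge u v i = edge v u i then w (edge u v i) * w (edge v u i) else 0) =
      ∑ i, (∑ r ∈ rowsIn k S, w (edge r r i)) ^ 2 := by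
    have : ∑ u ∈ rowsIn k S, ∑ v ∈ rowsIn k S, refMatrix w u v =
        ∑ i, ∑ u ∈ rowsIn k S, ∑ v ∈ rowsIn k S,
          if edge u v i = edge v u i then 0 else w (edge u v i) * w (edge v u i) := by
      simp only [refMatrix]
      rw [Finset.sum_comm' (s := Finset.univ) (t := fun _ => rowsIn k S)
        (s' := fun _ => Finset.univ) (t' := rowsIn k S) (by simp)]
      exact Finset.sum_congr rfl fun u _ => Finset.sum_comm
    rw [this, ← Finset.sum_add_distrib]
    refine Finset.sum_congr rfl fun i _ => ?_
    rw [← sum_sum_mul_eq_sq, ← Finset.sum_add_distrib]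
    refine Finset.sum_congr rfl fun u _ => ?_
    rw [← Finset.sum_add_distrib]
    refine Finset.sum_congr rfl fun v _ => ?_
    split_ifs <;> simp
  linarith

theorem trace_nonneg (H : UniformHypergraph n k) (D j : ℤ) :
    0 ≤ (refMatrix (weight H D j) ^ 2 ^ squarings n : Matrix (Row n k) (Row n k) ℤ).trace := by
  rw [squarings, pow_succ' 2, trace_even_pow (refMatrix_transpose _)]
  positivity

theorem indepNumber_lt_of_refute (hk : k ≠ 0) (H : UniformHypergraph n k) (b : ℕ)
    (h : refute k n H b = true) : H.indepNumber < b := by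
  by_contra hb
  rw [not_lt] at hb
  have hmem : H.indepNumber ∈ {m | ∃ S : Finset (Fin n), H.IsIndependent S ∧ S.card = m} := by
    refine Nat.sSup_mem ⟨0, ∅, fun e _ he => ?_, rfl⟩ ⟨n, ?_⟩
    · have := e.2
      rw [Finset.subset_empty.1 he, Finset.card_empty] at this
      exact hk this.symm
    · rintro m ⟨S, -, rfl⟩
      exact (Finset.card_le_univ S).trans (Fintype.card_fin n).le
  obtain ⟨S', hS', hcard⟩ := hmem
  -- Subsets of independent sets are independent, so one with exactly b elements exists.
  obtain ⟨S, hSS', rfl⟩ := Finset.exists_subset_card_eq (hb.trans hcard.ge)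
  have hS : H.IsIndependent S := fun e he hle => hS' e he (hle.trans hSS')
  rcases (refute_iff hk H _).1 h with hlt | ⟨j, -, hlt⟩
  · exact absurd ((Finset.card_le_univ S).trans (Fintype.card_fin n).le) (not_le.2 hlt)
  · refine absurd hlt (not_lt.2 ?_)
    have h1 := formBound_le hk hS j
    have h2 := sum_sum_pow_le_trace (refMatrix_transpose (k := k)
      (weight H ((4 * n ^ k : ℕ) : ℤ) (j : ℤ))) (rowsIn k S) n.size.size
    rw [card_rowsIn hk, Nat.cast_pow, show n.size.size + 1 = squarings n from rfl] at h2
    have h3 := trace_nonneg H ((4 * n ^ k : ℕ) : ℤ) (j : ℤ)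
    -- `formBound` uses truncated subtraction; when it truncates to 0, the certificate inequality
    -- fails because the trace is nonnegative.
    have hf : formBound n k S.card j (∑ x ∈ Finset.range (n ^ k), H.tensor x) = 0 ∨
        (formBound n k S.card j (∑ x ∈ Finset.range (n ^ k), H.tensor x) : ℤ) =
        (S.card * (j * (S.card + 1 - k : ℕ) ^ (k - 1)) ^ 2 - k ^ k * ((4 * n ^ k : ℕ) ^ 2 *
      (∑ x ∈ Finset.range (n ^ k), H.tensor x : ℕ) + j ^ 2 * n ^ k) : ℤ) := by
      rw [formBound]
      rcases le_total (S.card * (j * (S.card + 1 - k : ℕ) ^ (k - 1)) ^ 2) (k ^ k *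
        ((4 * n ^ k) ^ 2 * (∑ x ∈ Finset.range (n ^ k), H.tensor x) + j ^ 2 * n ^ k)) with hle | hle
      · exact .inl (Nat.sub_eq_zero_of_le hle)
      · refine .inr ?_
        rw [Nat.cast_sub hle]
        push_cast
        rfl
    rcases hf with hf | hf
    · rw [hf, Nat.cast_zero, zero_pow (by positivity)]
      positivity
    · rw [← hf] at h1
      have h4 := pow_le_pow_left₀ (Int.natCast_nonneg _) h1 (2 ^ squarings n)
      exact h4.trans (h2.trans_eq (mul_comm _ _))

end Refutation

namespace Refutation

/-! ## The expected trace -/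

section Bernoulli

variable {ι : Type} [Fintype ι] [DecidableEq ι]

/-- The probability of `H` as a random subset in which each element is included independently with
probability `q`. -/
def bernoulliWeight (q : ℝ) (H : Finset ι) : ℝ := q ^ H.card * (1 - q) ^ Hᶜ.card

/-- The expectation of a function of such a random subset. -/
def expect (q : ℝ) (f : Finset ι → ℝ) : ℝ := ∑ H, bernoulliWeight q H * f H

theorem bernoulliWeight_nonneg {q : ℝ} (h0 : 0 ≤ q) (h1 : q ≤ 1) (H : Finset ι) :
    0 ≤ bernoulliWeight q H :=
  mul_nonneg (pow_nonneg h0 _) (pow_nonneg (by linarith) _)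

/-- Independence, in the form of the expansion of a product of sums over subsets. -/
theorem expect_prod (q : ℝ) (f g : ι → ℝ) :
    expect q (fun H => ∏ e, if e ∈ H then f e else g e) = ∏ e, (q * f e + (1 - q) * g e) := by
  rw [Finset.prod_add, Finset.powerset_univ, expect]
  refine Finset.sum_congr rfl fun H _ => ?_
  rw [Finset.prod_ite, Finset.filter_univ_mem, Finset.prod_mul_distrib, Finset.prod_mul_distrib,
    Finset.prod_const, Finset.prod_const, bernoulliWeight, ← Finset.compl_eq_univ_sdiff,
    show Finset.univ.filter (fun e => e ∉ H) = Hᶜ by ext; simp]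
  ring

theorem expect_sum {κ : Type} (q : ℝ) (s : Finset κ) (f : κ → Finset ι → ℝ) :
    expect q (fun H => ∑ i ∈ s, f i H) = ∑ i ∈ s, expect q (f i) := by
  simp only [expect, Finset.mul_sum]
  exact Finset.sum_comm

theorem expect_zero (q : ℝ) : expect q (fun _ : Finset ι => 0) = 0 := by simp [expect]

theorem expect_add (q : ℝ) (f g : Finset ι → ℝ) :
    expect q (fun H => f H + g H) = expect q f + expect q g := by
  simp only [expect, mul_add, Finset.sum_add_distrib]

theorem expect_mul_const (q c : ℝ) (f : Finset ι → ℝ) :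
    expect q (fun H => f H * c) = expect q f * c := by
  simp only [expect, ← mul_assoc, Finset.sum_mul]

theorem expect_mono {q : ℝ} (h0 : 0 ≤ q) (h1 : q ≤ 1) {f g : Finset ι → ℝ}
    (h : ∀ H, f H ≤ g H) : expect q f ≤ expect q g :=
  Finset.sum_le_sum fun H _ => mul_le_mul_of_nonneg_left (h H) (bernoulliWeight_nonneg h0 h1 H)

theorem expect_indicator (q : ℝ) (e : ι) :
    expect q (fun H => if e ∈ H then 1 else 0) = q := by
  have h := expect_prod q (fun _ : ι => (1 : ℝ)) fun e' => if e' = e then 0 else 1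
  have h1 : ∀ H : Finset ι, (∏ e', if e' ∈ H then (1 : ℝ) else if e' = e then 0 else 1) =
      if e ∈ H then 1 else 0 := by
    intro H
    rw [Finset.prod_eq_single e (fun e' _ he' => by simp [he']) (by simp)]
    simp
  simp only [h1] at h
  rw [h, Finset.prod_eq_single e (fun e' _ he' => by simp [he']) (by simp)]
  simp

/-- A centered Bernoulli variable has mean zero, and its absolute moments of order at least 2 are at
most q. -/
theorem abs_centered_moment_le {q : ℝ} (h0 : 0 ≤ q) (h1 : q ≤ 1) {m : ℕ} (hm : m ≠ 0) :
    |q * (1 - q) ^ m + (1 - q) * (0 - q) ^ m| ≤ if m = 1 then 0 else q := by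
  split_ifs with hm1
  · subst hm1
    rw [show q * (1 - q) ^ 1 + (1 - q) * (0 - q) ^ 1 = 0 by ring, abs_zero]
  · obtain ⟨m, rfl⟩ : ∃ l, m = l + 2 := ⟨m - 2, by omega⟩
    have h2 : (0 : ℝ) ≤ 1 - q := by linarith
    have ha : (1 - q) ^ (m + 2) ≤ 1 - q := pow_le_of_le_one h2 (by linarith) (by omega)
    have hb : q ^ (m + 2) ≤ q ^ 2 := pow_le_pow_of_le_one h0 h1 (by omega)
    calc _ ≤ |q * (1 - q) ^ (m + 2)| + |(1 - q) * (0 - q) ^ (m + 2)| := abs_add_le _ _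
      _ = q * (1 - q) ^ (m + 2) + (1 - q) * q ^ (m + 2) := by
          rw [abs_mul, abs_mul, abs_pow, abs_pow, abs_of_nonneg h0, abs_of_nonneg h2, zero_sub,
            abs_neg, abs_of_nonneg h0]
      _ ≤ q * (1 - q) + (1 - q) * q ^ 2 :=
          add_le_add (mul_le_mul_of_nonneg_left ha h0) (mul_le_mul_of_nonneg_left hb h2)
      _ ≤ q := by nlinarith [mul_nonneg h0 (mul_nonneg h0 h0)]

/-- By independence the mean factors over distinct elements. An element of multiplicity one
contributes 0 and any other at most q, so a surviving list has length at least twice its number of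
distinct elements. -/
theorem abs_expect_list_prod_le {q : ℝ} (h0 : 0 ≤ q) (h1 : q ≤ 1) (h : List ι) :
    |expect q fun H => (h.map fun e => (if e ∈ H then 1 else 0) - q).prod| ≤
      if 2 * h.toFinset.card ≤ h.length then q ^ h.toFinset.card else 0 := by
  have h2 : ∀ H : Finset ι, (h.map fun e => (if e ∈ H then 1 else 0) - q).prod =
      ∏ e, if e ∈ H then (1 - q) ^ h.count e else (0 - q) ^ h.count e := by
    intro H
    rw [Finset.prod_list_map_count]
    refine (Finset.prod_subset (Finset.subset_univ _) fun e _ he => ?_).trans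
      (Finset.prod_congr rfl fun e _ => by split_ifs <;> rfl)
    rw [List.mem_toFinset] at he
    rw [List.count_eq_zero_of_not_mem he, pow_zero]
  simp only [h2]
  rw [expect_prod, Finset.abs_prod]
  have h3 : ∏ e, |q * (1 - q) ^ h.count e + (1 - q) * (0 - q) ^ h.count e| =
      ∏ e ∈ h.toFinset, |q * (1 - q) ^ h.count e + (1 - q) * (0 - q) ^ h.count e| := by
    refine (Finset.prod_subset (Finset.subset_univ _) fun e _ he => ?_).symm
    rw [List.mem_toFinset] at he
    rw [List.count_eq_zero_of_not_mem he]
    simp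
  rw [h3]
  have hcount : ∀ e ∈ h.toFinset, h.count e ≠ 0 := fun e he =>
    (List.count_pos_iff.2 (List.mem_toFinset.1 he)).ne'
  split_ifs with hlen
  · calc _ ≤ ∏ e ∈ h.toFinset, q := by
          refine Finset.prod_le_prod (fun _ _ => abs_nonneg _) fun e he => ?_
          refine (abs_centered_moment_le h0 h1 (hcount e he)).trans ?_
          split_ifs
          · exact h0
          · exact le_rfl
      _ = _ := by rw [Finset.prod_const]
  · obtain ⟨e, he, he1⟩ : ∃ e ∈ h.toFinset, h.count e = 1 := by
      by_contra hne
      push Not at hne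
      refine hlen ?_
      rw [← List.sum_toFinset_count_eq_length, mul_comm, ← smul_eq_mul, ← Finset.sum_const]
      refine Finset.sum_le_sum fun e he => ?_
      have := hcount e he
      have := hne e he
      omega
    refine (Finset.prod_eq_zero he ?_).le
    have := abs_centered_moment_le h0 h1 (hcount e he)
    rw [if_pos he1] at this
    exact le_antisymm this (abs_nonneg _)

end Bernoulli

variable {n k : ℕ}

theorem card_edge_le (hk : k ≠ 0) (u v : Row n k) (i : Fin n) : (edge u v i).card ≤ k := by
  have h1 : (Finset.univ.image u.1).card ≤ k / 2 := by
    simpa using Finset.card_image_le (s := Finset.univ) (f := u.1)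
  have h2 : (Finset.univ.image v.2).card ≤ k - 1 - k / 2 := by
    simpa using Finset.card_image_le (s := Finset.univ) (f := v.2)
  have h3 := half_add_half hk
  rw [edge]
  refine (Finset.card_union_le _ _).trans ?_
  have := Finset.card_union_le (Finset.univ.image u.1) (Finset.univ.image v.2)
  rw [Finset.card_singleton]
  omega

/-- Few completions of a partial tuple give a set from a given small family. -/
theorem sum_card_filter_le {m : ℕ} (hm : m + 1 ≤ k) (F : Finset (Finset (Fin n)))
    (hF : ∀ e ∈ F, e.card ≤ k) (g : (Fin m → Fin n) → Fin n → Finset (Fin n))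
    (hg : ∀ d i, (∀ c, d c ∈ g d i) ∧ i ∈ g d i) :
    ∑ i, (Finset.univ.filter fun d => g d i ∈ F).card ≤ F.card * k ^ k := by
  have h1 : ∀ i, (Finset.univ.filter fun d => g d i ∈ F).card ≤
      ∑ e ∈ F, if i ∈ e then k ^ m else 0 := by
    intro i
    have hsub : (Finset.univ.filter fun d => g d i ∈ F) ⊆
        F.biUnion fun e => if i ∈ e then Fintype.piFinset fun _ : Fin m => e else ∅ := by
      intro d hd
      rw [Finset.mem_filter] at hd
      rw [Finset.mem_biUnion]
      refine ⟨_, hd.2, ?_⟩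
      rw [if_pos (hg d i).2, Fintype.mem_piFinset]
      exact (hg d i).1
    refine ((Finset.card_le_card hsub).trans Finset.card_biUnion_le).trans ?_
    refine Finset.sum_le_sum fun e he => ?_
    split_ifs
    · rw [Fintype.card_piFinset_const]
      exact Nat.pow_le_pow_left (hF e he) m
    · simp
  calc _ ≤ ∑ i, ∑ e ∈ F, (if i ∈ e then k ^ m else 0) := Finset.sum_le_sum fun i _ => h1 i
    _ = ∑ e ∈ F, ∑ i, (if i ∈ e then k ^ m else 0) := Finset.sum_comm
    _ ≤ ∑ e ∈ F, k ^ k := by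
        refine Finset.sum_le_sum fun e he => ?_
        rw [← Finset.sum_filter, Finset.filter_univ_mem, Finset.sum_const, smul_eq_mul]
        calc _ ≤ k * k ^ m := Nat.mul_le_mul_right _ (hF e he)
          _ = k ^ (m + 1) := by ring
          _ ≤ _ := Nat.pow_le_pow_right (by omega) hm
    _ = _ := by rw [Finset.sum_const, smul_eq_mul]

/-- One step of the walk from u, with a factor z per new edge. For fixed i the first edge depends
only on the second part of v and the second edge only on the first part, so the sum over v factors.
Each part is either free, giving z times a power of n, or completes an edge of F, with at most R
completions over all i. The four resulting products are at most R² each. -/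
theorem sum_pow_card_insert_le (hk : k ≠ 0) {z R : ℝ} (hz : 0 ≤ z) (hz2 : k / 2 + 1 ≤ k)
    (F : Finset (Finset (Fin n))) (hF : ∀ e ∈ F, e.card ≤ k)
    (hR : (F.card * k ^ k : ℕ) ≤ R) (h1 : z * n ^ (k / 2) ≤ R)
    (h2 : z * n ^ (k - 1 - k / 2) ≤ R) (h3 : z ^ 2 * n ^ k ≤ R ^ 2) (u : Row n k) :
    ∑ v : Row n k, ∑ i, (if edge u v i = edge v u i then 0 else
      z ^ (insert (edge u v i) (insert (edge v u i) F)).card) ≤ 4 * R ^ 2 * z ^ F.card := by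
  have hR0 : 0 ≤ R := (Nat.cast_nonneg _).trans hR
  let p : (Fin (k - 1 - k / 2) → Fin n) → Fin n → Finset (Fin n) := fun d i => edge u (u.1, d) i
  let p' : (Fin (k / 2) → Fin n) → Fin n → Finset (Fin n) := fun d i => edge (d, u.2) u i
  have hp := sum_card_filter_le (k := k) (by omega) F hF p fun d i => by
    have := edge_subset.1 (Finset.Subset.refl (p d i)); exact this.2
  have hp' := sum_card_filter_le (k := k) hz2 F hF p' fun d i => by
    have := edge_subset.1 (Finset.Subset.refl (p' d i)); exact ⟨this.1, this.2.2⟩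
  set a : Fin n → ℕ := fun i => (Finset.univ.filter fun d => p d i ∈ F).card
  set a' : Fin n → ℕ := fun i => (Finset.univ.filter fun d => p' d i ∈ F).card
  -- The mask enters here: two equal new edges would contribute only one factor z.
  have hcard : ∀ e e' : Finset (Fin n), e ≠ e' → z ^ (insert e (insert e' F)).card ≤
      z ^ F.card * ((z + if e ∈ F then 1 else 0) * (z + if e' ∈ F then 1 else 0)) := by
    intro e e' hne
    have hzF : 0 ≤ z ^ F.card := pow_nonneg hz _
    by_cases he : e ∈ F
    · by_cases he' : e' ∈ F
      · rw [Finset.insert_eq_of_mem he', Finset.insert_eq_of_mem he, if_pos he, if_pos he']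
        nlinarith [mul_nonneg hzF hz, mul_nonneg hzF (mul_nonneg hz hz)]
      · rw [Finset.insert_eq_of_mem (Finset.mem_insert_of_mem he),
          Finset.card_insert_of_notMem he', if_pos he, if_neg he', pow_succ]
        nlinarith [mul_nonneg hzF hz, mul_nonneg hzF (mul_nonneg hz hz)]
    · by_cases he' : e' ∈ F
      · rw [Finset.insert_eq_of_mem he', Finset.card_insert_of_notMem he, if_neg he, if_pos he',
          pow_succ]
        nlinarith [mul_nonneg hzF hz, mul_nonneg hzF (mul_nonneg hz hz)]
      · rw [Finset.card_insert_of_notMem (by simp [hne, he]), Finset.card_insert_of_notMem he',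
          if_neg he, if_neg he', pow_succ, pow_succ]
        exact le_of_eq (by ring)
  have hA : (∑ i, (a i : ℝ)) ≤ R := le_trans (by exact_mod_cast hp) hR
  have hA' : (∑ i, (a' i : ℝ)) ≤ R := le_trans (by exact_mod_cast hp') hR
  -- All terms are nonnegative, so each `a' i` is bounded by the whole sum.
  have hAA' : ∑ i, (a i : ℝ) * a' i ≤ R * R :=
    (Finset.sum_le_sum fun i _ => mul_le_mul_of_nonneg_left
      ((Finset.single_le_sum (f := fun i => (a' i : ℝ)) (fun _ _ => Nat.cast_nonneg _)
        (Finset.mem_univ i)).trans hA') (Nat.cast_nonneg (a i))).trans (by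
      rw [← Finset.sum_mul]
      exact mul_le_mul_of_nonneg_right hA hR0)
  calc _ ≤ ∑ v : Row n k, ∑ i, z ^ F.card * ((z + if p v.2 i ∈ F then 1 else 0) *
          (z + if p' v.1 i ∈ F then 1 else 0)) := by
        refine Finset.sum_le_sum fun v _ => Finset.sum_le_sum fun i _ => ?_
        by_cases h : edge u v i = edge v u i
        · rw [if_pos h]
          positivity
        · rw [if_neg h]
          exact hcard _ _ h
    _ = z ^ F.card * ∑ i, (∑ d, (z + if p d i ∈ F then 1 else 0)) *
          ∑ d, (z + if p' d i ∈ F then 1 else 0) := by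
        rw [Finset.sum_comm, Finset.mul_sum]
        refine Finset.sum_congr rfl fun i _ => ?_
        rw [← Finset.mul_sum, Fintype.sum_prod_type, Finset.sum_mul_sum, Finset.sum_comm]
    _ = z ^ F.card * ∑ i, (z * n ^ (k - 1 - k / 2) + a i) * (z * n ^ (k / 2) + a' i) := by
        congr 1
        refine Finset.sum_congr rfl fun i _ => ?_
        rw [Finset.sum_add_distrib, Finset.sum_add_distrib, Finset.sum_boole, Finset.sum_boole]
        simp [a, a', mul_comm z]
    _ ≤ z ^ F.card * (4 * R ^ 2) := by
        refine mul_le_mul_of_nonneg_left ?_ (pow_nonneg hz _)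
        have hn : (n : ℝ) * ((z * n ^ (k - 1 - k / 2)) * (z * n ^ (k / 2))) = z ^ 2 * n ^ k := by
          have : k = (k - 1 - k / 2) + k / 2 + 1 := by
            have := half_add_half hk; omega
          calc _ = z ^ 2 * (n : ℝ) ^ ((k - 1 - k / 2) + k / 2 + 1) := by ring
            _ = _ := by rw [← this]
        have hx : (0 : ℝ) ≤ z * n ^ (k - 1 - k / 2) := by positivity
        have hy : (0 : ℝ) ≤ z * n ^ (k / 2) := by positivity
        generalize z * (n : ℝ) ^ (k - 1 - k / 2) = x at *
        generalize z * (n : ℝ) ^ (k / 2) = y at *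
        have he : ∑ i, (x + a i) * (y + a' i) =
            n * (x * y) + x * ∑ i, (a' i : ℝ) + y * ∑ i, (a i : ℝ) + ∑ i, (a i : ℝ) * a' i := by
          simp only [add_mul, mul_add, Finset.sum_add_distrib, Finset.mul_sum, Finset.sum_const,
            Finset.card_univ, Fintype.card_fin, nsmul_eq_mul, mul_comm _ y]
          ring
        have ha0 : 0 ≤ ∑ i, (a i : ℝ) := Finset.sum_nonneg fun _ _ => Nat.cast_nonneg _
        have ha0' : 0 ≤ ∑ i, (a' i : ℝ) := Finset.sum_nonneg fun _ _ => Nat.cast_nonneg _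
        have e1 : x * ∑ i, (a' i : ℝ) ≤ R * R := mul_le_mul h2 hA' ha0' hR0
        have e2 : y * ∑ i, (a i : ℝ) ≤ R * R := mul_le_mul h1 hA ha0 hR0
        rw [he, hn]
        nlinarith
    _ = _ := by ring

/-- The weights of the random hypergraph, as a function of its finite set of hyperedges. -/
noncomputable def randomWeight (q : ℝ) (H : Finset {e : Finset (Fin n) // e.card = k}) :
    Finset (Fin n) → ℝ := weight (↑H : Set {e : Finset (Fin n) // e.card = k}) 1 q

/-- A surviving product has d ≤ L distinct edges, and q^d = a^d·z^d ≤ a^L·z^d since a ≥ 1. The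
factor a^L is now independent of the walk, and z^d can be charged edge by edge. -/
theorem abs_expect_randomWeight_le {q a z : ℝ} (h0 : 0 ≤ q) (h1 : q ≤ 1) (ha : 1 ≤ a)
    (hz : 0 ≤ z) (haz : q = a * z) (L : ℕ) (h : List (Finset (Fin n))) (hL : h.length = 2 * L) :
    |expect q fun H : Finset {e : Finset (Fin n) // e.card = k} =>
      (h.map (randomWeight q H)).prod| ≤ a ^ L * z ^ h.toFinset.card := by
  have hnonneg : 0 ≤ a ^ L * z ^ h.toFinset.card := by positivity
  by_cases hh : ∀ e ∈ h, e.card = k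
  · lift h to List {e : Finset (Fin n) // e.card = k} using hh
    have hW : ∀ H : Finset {e : Finset (Fin n) // e.card = k},
        ((h.map Subtype.val).map (randomWeight q H)).prod =
        (h.map fun e => (if e ∈ H then 1 else 0) - q).prod := by
      intro H
      rw [List.map_map]
      congr 1
      refine List.map_congr_left fun e _ => ?_
      simp only [Function.comp_apply, randomWeight, weight]
      rw [dif_pos e.2]
      simp
    simp only [hW]
    refine (abs_expect_list_prod_le h0 h1 h).trans ?_
    have hcard : (h.map Subtype.val).toFinset.card = h.toFinset.card := by
      rw [← Finset.card_image_of_injective h.toFinset Subtype.val_injective]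
      congr 1
      ext
      simp
    rw [hcard] at hnonneg ⊢
    rw [List.length_map] at hL
    split_ifs with hle
    · rw [haz, mul_pow]
      exact mul_le_mul_of_nonneg_right (pow_le_pow_right₀ ha (by omega)) (pow_nonneg hz _)
    · exact hnonneg
  · push Not at hh
    obtain ⟨e, he, hek⟩ := hh
    have hW : ∀ H : Finset {e : Finset (Fin n) // e.card = k},
        (h.map (randomWeight q H)).prod = 0 := fun H =>
      List.prod_eq_zero (List.mem_map.2 ⟨e, he, by simp [randomWeight, weight, hek]⟩)
    simp only [hW, expect_zero, abs_zero]
    exact hnonneg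

/-- Induction on the remaining steps l of the walk, with h listing the edges already used. Peeling
off the first factor of the matrix power adds two edges to h, and `sum_pow_card_insert_le` bounds
the sum over that step by 4R². -/
theorem sum_abs_expect_le (hk : k ≠ 0) (hk2 : k / 2 + 1 ≤ k) {q a z R : ℝ} (h0 : 0 ≤ q)
    (h1 : q ≤ 1) (ha : 1 ≤ a)
    (hz : 0 ≤ z) (haz : q = a * z) {L : ℕ} (hR : (2 * L * k ^ k : ℕ) ≤ R)
    (hz1 : z * n ^ (k / 2) ≤ R) (hz2 : z * n ^ (k - 1 - k / 2) ≤ R)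
    (hz3 : z ^ 2 * n ^ k ≤ R ^ 2) (l : ℕ) (h : List (Finset (Fin n)))
    (hcard : ∀ e ∈ h, e.card ≤ k) (hL : h.length + 2 * l = 2 * L) (u : Row n k) :
    ∑ v : Row n k, |expect q fun H : Finset {e : Finset (Fin n) // e.card = k} =>
      (h.map (randomWeight q H)).prod *
        (refMatrix (randomWeight q H) ^ l : Matrix (Row n k) (Row n k) ℝ) u v| ≤
      (4 * R ^ 2) ^ l * (a ^ L * z ^ h.toFinset.card) := by
  induction l generalizing h u with
  | zero =>
    rw [Finset.sum_eq_single u]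
    · simpa using abs_expect_randomWeight_le h0 h1 ha hz haz L h (by omega)
    · intro v _ hv
      simp [Matrix.one_apply_ne hv.symm, expect_zero]
    · simp
  | succ l ih =>
    have hexp : ∀ v : Row n k, (expect q fun H : Finset {e : Finset (Fin n) // e.card = k} =>
        (h.map (randomWeight q H)).prod *
          (refMatrix (randomWeight q H) ^ (l + 1) : Matrix (Row n k) (Row n k) ℝ) u v) =
        ∑ w : Row n k, ∑ i, if edge u w i = edge w u i then 0 else
          expect q fun H : Finset {e : Finset (Fin n) // e.card = k} =>
            ((edge u w i :: edge w u i :: h).map (randomWeight q H)).prod *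
              (refMatrix (randomWeight q H) ^ l : Matrix (Row n k) (Row n k) ℝ) w v := by
      intro v
      have : ∀ H : Finset {e : Finset (Fin n) // e.card = k}, (h.map (randomWeight q H)).prod *
          (refMatrix (randomWeight q H) ^ (l + 1) : Matrix (Row n k) (Row n k) ℝ) u v =
          ∑ w : Row n k, ∑ i, if edge u w i = edge w u i then 0 else
            ((edge u w i :: edge w u i :: h).map (randomWeight q H)).prod *
              (refMatrix (randomWeight q H) ^ l : Matrix (Row n k) (Row n k) ℝ) w v := by
        intro H
        rw [pow_succ', Matrix.mul_apply, Finset.mul_sum]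
        refine Finset.sum_congr rfl fun w _ => ?_
        conv_lhs => rw [refMatrix, Finset.sum_mul, Finset.mul_sum]
        refine Finset.sum_congr rfl fun i _ => ?_
        split_ifs
        · simp
        · simp only [List.map_cons, List.prod_cons]
          ring
      simp only [this, expect_sum]
      refine Finset.sum_congr rfl fun w _ => Finset.sum_congr rfl fun i _ => ?_
      split_ifs
      · exact expect_zero q
      · rfl
    have hF : (h.toFinset.card * k ^ k : ℕ) ≤ R := by
      refine le_trans ?_ hR
      have : h.toFinset.card ≤ 2 * L := (List.toFinset_card_le h).trans (by omega)
      exact_mod_cast Nat.mul_le_mul_right _ this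
    have hstep := sum_pow_card_insert_le hk hz hk2 h.toFinset
      (fun e he => hcard e (List.mem_toFinset.1 he)) hF hz1 hz2 hz3 u
    have hK : 0 ≤ (4 * R ^ 2) ^ l * a ^ L := by positivity
    calc _ ≤ ∑ v : Row n k, ∑ w : Row n k, ∑ i, (if edge u w i = edge w u i then 0 else
          |expect q fun H : Finset {e : Finset (Fin n) // e.card = k} =>
            ((edge u w i :: edge w u i :: h).map (randomWeight q H)).prod *
              (refMatrix (randomWeight q H) ^ l : Matrix (Row n k) (Row n k) ℝ) w v|) := by
          refine Finset.sum_le_sum fun v _ => ?_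
          rw [hexp v]
          refine (Finset.abs_sum_le_sum_abs _ _).trans (Finset.sum_le_sum fun w _ => ?_)
          refine (Finset.abs_sum_le_sum_abs _ _).trans (Finset.sum_le_sum fun i _ => ?_)
          split_ifs
          · simp
          · exact le_rfl
      _ = ∑ w : Row n k, ∑ i, (if edge u w i = edge w u i then 0 else
          ∑ v : Row n k, |expect q fun H : Finset {e : Finset (Fin n) // e.card = k} =>
            ((edge u w i :: edge w u i :: h).map (randomWeight q H)).prod *
              (refMatrix (randomWeight q H) ^ l : Matrix (Row n k) (Row n k) ℝ) w v|) := by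
          rw [Finset.sum_comm]
          refine Finset.sum_congr rfl fun w _ => ?_
          rw [Finset.sum_comm]
          refine Finset.sum_congr rfl fun i _ => ?_
          split_ifs
          · simp
          · rfl
      _ ≤ ∑ w : Row n k, ∑ i, (4 * R ^ 2) ^ l * a ^ L *
          (if edge u w i = edge w u i then 0 else
            z ^ (insert (edge u w i) (insert (edge w u i) h.toFinset)).card) := by
          refine Finset.sum_le_sum fun w _ => Finset.sum_le_sum fun i _ => ?_
          split_ifs
          · simp
          · refine (ih (edge u w i :: edge w u i :: h) ?_ ?_ w).trans_eq ?_
            · intro e he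
              rw [List.mem_cons, List.mem_cons] at he
              rcases he with rfl | rfl | he
              · exact card_edge_le hk _ _ _
              · exact card_edge_le hk _ _ _
              · exact hcard e he
            · simp only [List.length_cons]
              omega
            · rw [List.toFinset_cons, List.toFinset_cons, mul_assoc]
      _ ≤ (4 * R ^ 2) ^ l * a ^ L * (4 * R ^ 2 * z ^ h.toFinset.card) := by
          simp only [← Finset.mul_sum]
          exact mul_le_mul_of_nonneg_left hstep hK
      _ = _ := by ring

/-- A diagonal entry is bounded by its whole row: the walk need not close. The loss is only the
number of rows, harmless after an L-th root. -/
theorem expect_trace_le (hk : k ≠ 0) (hk2 : k / 2 + 1 ≤ k) {q a z R : ℝ} (h0 : 0 ≤ q)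
    (h1 : q ≤ 1) (ha : 1 ≤ a)
    (hz : 0 ≤ z) (haz : q = a * z) {L : ℕ} (hR : (2 * L * k ^ k : ℕ) ≤ R)
    (hz1 : z * n ^ (k / 2) ≤ R) (hz2 : z * n ^ (k - 1 - k / 2) ≤ R)
    (hz3 : z ^ 2 * n ^ k ≤ R ^ 2) :
    (expect q fun H : Finset {e : Finset (Fin n) // e.card = k} =>
      (refMatrix (randomWeight q H) ^ L : Matrix (Row n k) (Row n k) ℝ).trace) ≤
      n ^ (k - 1) * (4 * R ^ 2 * a) ^ L := by
  simp only [Matrix.trace, expect_sum]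
  calc _ ≤ ∑ _u : Row n k, (4 * R ^ 2 * a) ^ L := by
        refine Finset.sum_le_sum fun u _ => ?_
        have h := sum_abs_expect_le hk hk2 h0 h1 ha hz haz hR hz1 hz2 hz3 L [] (by simp) (by simp) u
        simp only [List.map_nil, List.prod_nil, one_mul, List.toFinset_nil, Finset.card_empty,
          pow_zero, mul_one] at h
        rw [mul_pow]
        refine le_trans ?_ h
        exact (le_abs_self _).trans (Finset.single_le_sum
          (f := fun v => |expect q fun H : Finset {e : Finset (Fin n) // e.card = k} =>
            (refMatrix (randomWeight q H) ^ L : Matrix (Row n k) (Row n k) ℝ) u v|)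
          (fun _ _ => abs_nonneg _) (Finset.mem_univ u))
    _ = _ := by
        rw [Finset.sum_const, Finset.card_univ, Fintype.card_congr (rowEquiv n hk),
          Fintype.card_fin, nsmul_eq_mul]
        push_cast
        rfl

end Refutation

namespace Refutation

/-! ## The algorithm succeeds with high probability -/

variable {n k : ℕ}

theorem random_real_eq (p : unitInterval) (S : Set (UniformHypergraph n k)) [DecidablePred (· ∈ S)] :
    (UniformHypergraph.random n k p).real S = expect (p : ℝ)
      fun H : Finset {e : Finset (Fin n) // e.card = k} =>
        if (H : Set {e : Finset (Fin n) // e.card = k}) ∈ S then 1 else 0 := by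
  classical
  have h : (UniformHypergraph.random n k p).real S =
      ∑ H : UniformHypergraph n k, if H ∈ S then
        (UniformHypergraph.random n k p).real {H} else 0 := by
    rw [← Finset.sum_filter, UniformHypergraph.random,
      MeasureTheory.sum_measureReal_singleton]
    simp
  rw [h, ← Fintype.finsetEquivSet.sum_comp, expect]
  refine Finset.sum_congr rfl fun H _ => ?_
  rw [Fintype.finsetEquivSet_apply, mul_ite, mul_one, mul_zero, UniformHypergraph.random,
    ProbabilityTheory.setBernoulli_real_singleton p (Set.subset_univ _) Set.finite_univ,
    Set.ncard_coe_finset, ← Set.compl_eq_univ_sdiff, ← Finset.coe_compl, Set.ncard_coe_finset]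
  rfl

/-- Bernoulli's inequality: (1 - 2/D)^m ≥ 1 - 2m/D ≥ 1/2. -/
theorem pow_le_two_mul_pow {x y D : ℝ} (hx : 0 ≤ x) {m : ℕ} (hD : 0 < D) (hD2 : 2 ≤ D)
    (hm : 4 * m ≤ D) (hy : x * (1 - 2 / D) ≤ y) : x ^ m ≤ 2 * y ^ m := by
  have h2 : 2 / D ≤ 1 := (div_le_one hD).2 hD2
  have h1 : (1 : ℝ) / 2 ≤ (1 - 2 / D) ^ m := by
    have h3 := one_add_mul_le_pow (show (-2 : ℝ) ≤ -(2 / D) by linarith) m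
    have h4 : m * (2 / D) ≤ 1 / 2 := by
      rw [mul_div_assoc', div_le_iff₀ hD]
      linarith
    rw [← sub_eq_add_neg] at h3
    linarith
  have h5 := pow_le_pow_left₀ (mul_nonneg hx (by linarith)) hy m
  rw [mul_pow] at h5
  nlinarith [pow_nonneg hx m]

theorem card_hyperedges_le : Fintype.card {e : Finset (Fin n) // e.card = k} ≤ n ^ k := by
  rw [Fintype.card_finset_len, Fintype.card_fin]
  exact Nat.choose_le_pow n k

/-- Every edge probability is close to a multiple of `1 / D`. -/
theorem exists_grid_point (hn : 1 ≤ n ^ k) {p : ℝ} (hp0 : 0 ≤ p) (hp1 : p ≤ 1) :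
    ∃ j ≤ 4 * n ^ k, p / 2 ≤ (j : ℝ) / (4 * n ^ k : ℕ) ∧
      ∀ H : Finset {e : Finset (Fin n) // e.card = k},
        bernoulliWeight p H ≤ 2 * bernoulliWeight ((j : ℝ) / (4 * n ^ k : ℕ)) H := by
  set D : ℕ := 4 * n ^ k with hD_def
  have hD4 : (4 : ℝ) ≤ D := by rw [hD_def]; exact_mod_cast (by omega : 4 ≤ 4 * n ^ k)
  have hD : (0 : ℝ) < D := by linarith
  have hm : ∀ H : Finset {e : Finset (Fin n) // e.card = k}, 4 * (H.card : ℝ) ≤ D := fun H => by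
    have h : H.card ≤ n ^ k := (Finset.card_le_univ H).trans card_hyperedges_le
    rw [hD_def]
    exact_mod_cast Nat.mul_le_mul_left 4 h
  have hinv : 2 / (D : ℝ) ≤ 1 / 2 := by
    rw [div_le_div_iff₀ hD (by norm_num)]; linarith
  have hinv' : 1 / (D : ℝ) = 2 / D / 2 := by ring
  have hinv0 : 0 < 2 / (D : ℝ) := by positivity
  -- Rounding goes toward 1/2 or past it by less than 1/D: up for small p, down for large p. One of
  -- the bases q, 1 - q can only increase, and the other starts at 1/2 or more, so it loses at most
  -- the relative amount 2/D.
  rcases lt_or_ge p (1 / 2) with hp | hp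
  · have hc1 : p ≤ (⌈p * D⌉₊ : ℝ) / D := (le_div_iff₀ hD).2 (Nat.le_ceil _)
    have hc2 : (⌈p * D⌉₊ : ℝ) / D ≤ p + 1 / D := by
      rw [div_le_iff₀ hD, add_mul, one_div_mul_cancel hD.ne']
      exact (Nat.ceil_lt_add_one (by positivity)).le
    refine ⟨⌈p * D⌉₊, Nat.ceil_le.2 (by nlinarith), by linarith, fun H => ?_⟩
    have h1 := pow_le_two_mul_pow (x := 1 - p) (y := 1 - (⌈p * D⌉₊ : ℝ) / D) (by linarith) hD
      (by linarith) (hm Hᶜ) (by nlinarith)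
    have h2 := pow_le_pow_left₀ hp0 hc1 H.card
    rw [bernoulliWeight, bernoulliWeight]
    calc _ ≤ ((⌈p * D⌉₊ : ℝ) / D) ^ H.card * (2 * (1 - (⌈p * D⌉₊ : ℝ) / D) ^ Hᶜ.card) :=
          mul_le_mul h2 h1 (pow_nonneg (by linarith) _) (by positivity)
      _ = _ := by ring
  · have hc1 : (⌊p * D⌋₊ : ℝ) / D ≤ p := (div_le_iff₀ hD).2 (Nat.floor_le (by positivity))
    have hc2 : p - 1 / D ≤ (⌊p * D⌋₊ : ℝ) / D := by
      rw [le_div_iff₀ hD, sub_mul, one_div_mul_cancel hD.ne']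
      linarith [(Nat.lt_floor_add_one (p * D))]
    refine ⟨⌊p * D⌋₊, Nat.floor_le_of_le (by nlinarith), by linarith, fun H => ?_⟩
    have h1 := pow_le_two_mul_pow (x := p) (y := (⌊p * D⌋₊ : ℝ) / D) hp0 hD
      (by linarith) (hm H) (by nlinarith)
    have h2 := pow_le_pow_left₀ (by linarith) (show 1 - p ≤ 1 - (⌊p * D⌋₊ : ℝ) / D by linarith)
      Hᶜ.card
    rw [bernoulliWeight, bernoulliWeight]
    calc _ ≤ (2 * ((⌊p * D⌋₊ : ℝ) / D) ^ H.card) * (1 - (⌊p * D⌋₊ : ℝ) / D) ^ Hᶜ.card :=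
          mul_le_mul h1 h2 (pow_nonneg (by linarith) _) (by positivity)
      _ = _ := by ring

theorem expect_tensor_le {q : ℝ} (h0 : 0 ≤ q) :
    (expect q fun H : Finset {e : Finset (Fin n) // e.card = k} =>
      ((∑ x ∈ Finset.range (n ^ k), UniformHypergraph.tensor
        (H : Set {e : Finset (Fin n) // e.card = k}) x : ℕ) : ℝ)) ≤ n ^ k * q := by
  push_cast
  rw [expect_sum]
  calc _ ≤ ∑ _x ∈ Finset.range (n ^ k), q := by
        refine Finset.sum_le_sum fun x hx => ?_
        have hx' := Finset.mem_range.1 hx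
        by_cases hc : (Finset.univ.image (finFunctionFinEquiv.symm (⟨x, hx'⟩ : Fin (n ^ k)))).card = k
        · refine le_of_eq ?_
          refine Eq.trans ?_ (expect_indicator q (⟨_, hc⟩ : {e : Finset (Fin n) // e.card = k}))
          congr 1
          funext H
          have := tensor_eq (H : Set {e : Finset (Fin n) // e.card = k}) hx'
            (digitSet_eq_image hx') 1 0 hc
          rw [weight, dif_pos hc, one_mul, sub_zero, sub_zero] at this
          rw [← Int.cast_natCast (R := ℝ), this]
          simp
        · refine le_trans (le_of_eq ?_) h0
          rw [← expect_zero (ι := {e : Finset (Fin n) // e.card = k}) q]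
          congr 1
          funext H
          rw [UniformHypergraph.tensor, dif_pos hx', if_neg, Nat.cast_zero]
          rintro ⟨e, -, he⟩
          exact hc (he ▸ e.2)
    _ = _ := by simp

theorem weight_cast_eq (H : UniformHypergraph n k) {D j : ℕ} (hD : D ≠ 0) (e : Finset (Fin n)) :
    ((weight H (D : ℤ) (j : ℤ) e : ℤ) : ℝ) = D * weight H (1 : ℝ) ((j : ℝ) / D) e := by
  have hD' : (D : ℝ) ≠ 0 := by exact_mod_cast hD
  rw [weight, weight]
  split_ifs <;> simp <;> field_simp

theorem refMatrix_cast_eq (H : UniformHypergraph n k) {D j : ℕ} (hD : D ≠ 0) :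
    (refMatrix (weight H (D : ℤ) (j : ℤ)) : Matrix (Row n k) (Row n k) ℤ).map (Int.castRingHom ℝ) =
      (D : ℝ) ^ 2 • refMatrix (weight H (1 : ℝ) ((j : ℝ) / D)) := by
  ext u v
  simp only [Matrix.map_apply, refMatrix, Matrix.smul_apply, smul_eq_mul, Finset.mul_sum,
    map_sum]
  refine Finset.sum_congr rfl fun i _ => ?_
  split_ifs
  · simp
  · simp only [map_mul, eq_intCast, weight_cast_eq H hD]
    ring

theorem trace_cast_eq (H : UniformHypergraph n k) {D j : ℕ} (hD : D ≠ 0) (l : ℕ) :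
    (((refMatrix (weight H (D : ℤ) (j : ℤ)) ^ l : Matrix (Row n k) (Row n k) ℤ).trace : ℤ) : ℝ) =
      ((D : ℝ) ^ 2) ^ l *
        (refMatrix (weight H (1 : ℝ) ((j : ℝ) / D)) ^ l : Matrix (Row n k) (Row n k) ℝ).trace := by
  have h := congrArg (fun M : Matrix (Row n k) (Row n k) ℝ => (M ^ l).trace)
    (refMatrix_cast_eq H (j := j) hD)
  simp only [smul_pow, Matrix.trace_smul, smul_eq_mul] at h
  rw [← h]
  rw [← Matrix.map_pow]
  simp [Matrix.trace]

theorem formBound_cast_ge (b j m : ℕ) (hn : n ≠ 0) :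
    ((4 * n ^ k : ℕ) : ℝ) ^ 2 *
      (b * (((j : ℝ) / (4 * n ^ k : ℕ)) * (b + 1 - k : ℕ) ^ (k - 1)) ^ 2 -
        k ^ k * (m + ((j : ℝ) / (4 * n ^ k : ℕ)) ^ 2 * n ^ k)) ≤ formBound n k b j m := by
  have hD' : ((4 * n ^ k : ℕ) : ℝ) ≠ 0 := by positivity
  have h : ((b * (j * (b + 1 - k) ^ (k - 1)) ^ 2 : ℕ) : ℝ) -
      ((k ^ k * ((4 * n ^ k) ^ 2 * m + j ^ 2 * n ^ k) : ℕ) : ℝ) ≤ formBound n k b j m := by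
    rw [formBound, sub_le_iff_le_add]
    exact_mod_cast le_tsub_add
  refine le_trans (le_of_eq ?_) h
  generalize hDD : 4 * n ^ k = D at *
  push_cast
  field_simp

/-- If the algorithm fails, then the number of hyperedges or the trace is large. -/
theorem one_le_of_refute_eq_false (hk : k ≠ 0) (hn : n ≠ 0) (H : UniformHypergraph n k) {b j : ℕ}
    {q G T : ℝ} (hj : j ≤ 4 * n ^ k) (hq : q = (j : ℝ) / (4 * n ^ k : ℕ)) (hT : 0 < T)
    (hG : 0 < G)
    (hGT : k ^ k * (T + q ^ 2 * n ^ k) + G ≤ b * (q * (b + 1 - k : ℕ) ^ (k - 1)) ^ 2)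
    (h : refute k n H b = false) :
    1 ≤ (∑ x ∈ Finset.range (n ^ k), H.tensor x : ℕ) * T⁻¹ +
      (refMatrix (weight H 1 q) ^ 2 ^ squarings n : Matrix (Row n k) (Row n k) ℝ).trace *
        ((b : ℝ) ^ (k - 1) / G) ^ 2 ^ squarings n := by
  have htr : 0 ≤ (refMatrix (weight H 1 q) ^ 2 ^ squarings n :
      Matrix (Row n k) (Row n k) ℝ).trace := by
    rw [squarings, pow_succ' 2, trace_even_pow (refMatrix_transpose _)]
    positivity
  have htr' : 0 ≤ (refMatrix (weight H 1 q) ^ 2 ^ squarings n :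
      Matrix (Row n k) (Row n k) ℝ).trace * ((b : ℝ) ^ (k - 1) / G) ^ 2 ^ squarings n := by
    positivity
  rcases le_or_gt T (∑ x ∈ Finset.range (n ^ k), H.tensor x : ℕ) with hle | hlt
  · have : 1 ≤ (∑ x ∈ Finset.range (n ^ k), H.tensor x : ℕ) * T⁻¹ := by
      rw [← div_eq_mul_inv, one_le_div hT]
      exact hle
    linarith
  · have hD : 4 * n ^ k ≠ 0 := by positivity
    have hnot := mt (refute_iff hk H b).2 (by simp [h])
    push Not at hnot
    have h1 := hnot.2 j hj
    have h2 : ((formBound n k b j (∑ x ∈ Finset.range (n ^ k), H.tensor x) : ℤ) : ℝ) ^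
        2 ^ squarings n ≤ ((refMatrix (weight H ((4 * n ^ k : ℕ) : ℤ) j) ^ 2 ^ squarings n :
        Matrix (Row n k) (Row n k) ℤ).trace : ℝ) * ((b : ℝ) ^ (k - 1)) ^ 2 ^ squarings n := by
      exact_mod_cast h1
    rw [trace_cast_eq H hD, ← hq, Int.cast_natCast] at h2
    have h3 := formBound_cast_ge (n := n) (k := k) b j (∑ x ∈ Finset.range (n ^ k), H.tensor x) hn
    rw [← hq] at h3
    have hDpos : (0 : ℝ) < ((4 * n ^ k : ℕ) : ℝ) ^ 2 := by positivity
    have h4 : ((4 * n ^ k : ℕ) : ℝ) ^ 2 * G ≤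
        formBound n k b j (∑ x ∈ Finset.range (n ^ k), H.tensor x) := by
      refine le_trans (mul_le_mul_of_nonneg_left ?_ hDpos.le) h3
      have : (k : ℝ) ^ k * ((∑ x ∈ Finset.range (n ^ k), H.tensor x : ℕ) + q ^ 2 * n ^ k) ≤
          k ^ k * (T + q ^ 2 * n ^ k) :=
        mul_le_mul_of_nonneg_left (by linarith) (by positivity)
      linarith
    have h5 := (pow_le_pow_left₀ (by positivity) h4 (2 ^ squarings n)).trans h2
    rw [mul_pow, mul_assoc] at h5
    have h6 := le_of_mul_le_mul_left h5 (by positivity)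
    have h7 : 1 ≤ (refMatrix (weight H 1 q) ^ 2 ^ squarings n :
        Matrix (Row n k) (Row n k) ℝ).trace * ((b : ℝ) ^ (k - 1) / G) ^ 2 ^ squarings n := by
      rw [div_pow, mul_div_assoc', one_le_div (by positivity)]
      exact h6
    have : 0 ≤ ((∑ x ∈ Finset.range (n ^ k), H.tensor x : ℕ) : ℝ) * T⁻¹ := by positivity
    linarith

/-- Markov's inequality: on failure, a nonnegative sum of the scaled edge count and the scaled trace
is at least 1. -/
theorem expect_refute_eq_false_le (hk : 2 ≤ k) (hn : n ≠ 0) {b j : ℕ}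
    {q G T s : ℝ} (hj : j ≤ 4 * n ^ k) (hq : q = (j : ℝ) / (4 * n ^ k : ℕ)) (hT : 0 < T)
    (hG : 0 < G)
    (hGT : k ^ k * (T + q ^ 2 * n ^ k) + G ≤ b * (q * (b + 1 - k : ℕ) ^ (k - 1)) ^ 2)
    (hs : 1 ≤ s) (hsn : s ^ 2 = n) (hR : (2 * 2 ^ squarings n * k ^ k : ℕ) ≤ s ^ k * q) :
    (expect q fun H : Finset {e : Finset (Fin n) // e.card = k} =>
      if refute k n (H : Set {e : Finset (Fin n) // e.card = k}) b = false then 1 else 0) ≤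
    n ^ k * q * T⁻¹ + n ^ (k - 1) * (4 * (2 * 2 ^ squarings n * k ^ k : ℕ) * (s ^ k * q) *
      (b ^ (k - 1) / G)) ^ 2 ^ squarings n := by
  have hk0 : k ≠ 0 := by omega
  have h0 : 0 ≤ q := by rw [hq]; positivity
  have h1 : q ≤ 1 := by
    rw [hq]
    exact div_le_one_of_le₀ (by exact_mod_cast hj) (by positivity)
  set R : ℝ := ((2 * 2 ^ squarings n * k ^ k : ℕ) : ℝ) with hR_def
  have hRpos : 0 < R := by
    rw [hR_def]
    have : 0 < k := by omega
    positivity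
  have hspos : 0 < s ^ k := by positivity
  have hhalf : ∀ m, 2 * m ≤ k → R / s ^ k * n ^ m ≤ R := by
    intro m hm
    rw [← hsn, ← pow_mul, div_mul_eq_mul_div, div_le_iff₀ hspos]
    exact mul_le_mul_of_nonneg_left (pow_le_pow_right₀ hs hm) hRpos.le
  -- The choice z = R/n^(k/2) gives equality in z²n^k ≤ R²; it is the largest admissible z, and a =
  -- q/z turns 4R²a into 4R·n^(k/2)·q.
  have htrace := expect_trace_le (n := n) (k := k) hk0 (by omega) h0 h1 (a := s ^ k * q / R)
    (z := R / s ^ k) (R := R) (L := 2 ^ squarings n) ((one_le_div hRpos).2 hR) (by positivity)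
    (by field_simp) le_rfl (hhalf _ (by omega)) (hhalf _ (by omega)) (by
      rw [div_pow, ← hsn, ← pow_mul, ← pow_mul, mul_comm k 2, div_mul_cancel₀ _ (by positivity)])
  calc _ ≤ expect q fun H : Finset {e : Finset (Fin n) // e.card = k} =>
        (∑ x ∈ Finset.range (n ^ k), UniformHypergraph.tensor
          (H : Set {e : Finset (Fin n) // e.card = k}) x : ℕ) * T⁻¹ +
        (refMatrix (randomWeight q H) ^ 2 ^ squarings n : Matrix (Row n k) (Row n k) ℝ).trace *
          ((b : ℝ) ^ (k - 1) / G) ^ 2 ^ squarings n := by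
        refine expect_mono h0 h1 fun H => ?_
        split_ifs with h
        · exact one_le_of_refute_eq_false hk0 hn _ hj hq hT hG hGT h
        · have htr : 0 ≤ (refMatrix (randomWeight q H) ^ 2 ^ squarings n :
              Matrix (Row n k) (Row n k) ℝ).trace := by
            rw [squarings, pow_succ' 2, trace_even_pow (refMatrix_transpose _)]
            positivity
          positivity
    _ ≤ n ^ k * q * T⁻¹ + n ^ (k - 1) * (4 * R ^ 2 * (s ^ k * q / R)) ^ 2 ^ squarings n *
          ((b : ℝ) ^ (k - 1) / G) ^ 2 ^ squarings n := by
        rw [expect_add, expect_mul_const, expect_mul_const]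
        exact add_le_add (mul_le_mul_of_nonneg_right (expect_tensor_le h0) (by positivity))
          (mul_le_mul_of_nonneg_right htrace (by positivity))
    _ = _ := by
        rw [mul_assoc ((n : ℝ) ^ (k - 1)), ← mul_pow,
          show 4 * R ^ 2 * (s ^ k * q / R) = 4 * R * (s ^ k * q) by field_simp]

/-- The grid value j is one of the centerings tried by the algorithm, so the analysis may assume
edge probability exactly j/D, at the cost of a factor 2. -/
theorem random_real_refute_le (hn : 1 ≤ n ^ k) (p : unitInterval) (b : ℕ) :
    ∃ j ≤ 4 * n ^ k, (p : ℝ) / 2 ≤ (j : ℝ) / (4 * n ^ k : ℕ) ∧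
      (UniformHypergraph.random n k p).real {H | refute k n H b = false} ≤
        2 * expect ((j : ℝ) / (4 * n ^ k : ℕ))
          fun H : Finset {e : Finset (Fin n) // e.card = k} =>
            if refute k n (H : Set {e : Finset (Fin n) // e.card = k}) b = false then 1 else 0 := by
  obtain ⟨j, hj, hp, hw⟩ := exists_grid_point hn p.2.1 p.2.2
  refine ⟨j, hj, hp, ?_⟩
  classical
  rw [random_real_eq, expect, expect, Finset.mul_sum]
  refine Finset.sum_le_sum fun H _ => ?_
  rw [← mul_assoc]
  have h01 : (0 : ℝ) ≤
      if refute k n (H : Set {e : Finset (Fin n) // e.card = k}) b = false then 1 else 0 := by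
    split_ifs <;> norm_num
  convert mul_le_mul_of_nonneg_right (hw H) h01 using 2
  simp

end Refutation

/-! ### Choice of parameters and passage to the limit -/

namespace Refutation

variable {n k : ℕ}

theorem two_pow_squarings_le_log (hn : 1 ≤ Real.log n) :
    ((2 * 2 ^ squarings n * k ^ k : ℕ) : ℝ) ≤ 28 * k ^ k * Real.log n := by
  have hn0 : n ≠ 0 := by
    rintro rfl
    norm_num at hn
  have h1 : (n.size : ℝ) ≤ 3 * Real.log n := by
    have h2 : 2 ^ (n.size - 1) ≤ n := Nat.lt_size.1 (Nat.sub_lt (Nat.size_pos.2 (by omega)) one_pos)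
    have h3 : ((n.size - 1 : ℕ) : ℝ) * Real.log 2 ≤ Real.log n := by
      rw [← Real.log_pow]
      exact Real.log_le_log (by positivity) (by exact_mod_cast h2)
    have h4 := Real.log_two_gt_d9
    have h5 : (n.size : ℝ) ≤ ((n.size - 1 : ℕ) : ℝ) + 1 := by exact_mod_cast (by omega)
    have h6 : (0 : ℝ) ≤ ((n.size - 1 : ℕ) : ℝ) := Nat.cast_nonneg _
    nlinarith
  have h2 : ((2 ^ squarings n : ℕ) : ℝ) ≤ 4 * n.size + 2 := by
    exact_mod_cast two_pow_squarings_le n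
  have hk : (0 : ℝ) ≤ k ^ k := by positivity
  calc ((2 * 2 ^ squarings n * k ^ k : ℕ) : ℝ) = 2 * ((2 ^ squarings n : ℕ) : ℝ) * k ^ k := by
        push_cast; ring
    _ ≤ 2 * (14 * Real.log n) * k ^ k := by
        refine mul_le_mul_of_nonneg_right ?_ hk
        linarith
    _ = _ := by ring

/-- The trace exponent L is at least the binary length of n, so a factor 2^(-kL) outweighs the
n^(k-1) rows. -/
theorem lt_two_pow_two_pow_squarings (n : ℕ) : n < 2 ^ 2 ^ squarings n := by
  refine (Nat.lt_size_self n).trans_le (Nat.pow_le_pow_right (by norm_num) ?_)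
  refine (Nat.lt_size_self n.size).le.trans (Nat.pow_le_pow_right (by norm_num) ?_)
  exact Nat.le_succ _

/-- The constant in the density condition. -/
def densityConst (k : ℕ) : ℝ := 112 * 8 ^ k * k ^ k

theorem densityConst_pos (hk : k ≠ 0) : 0 < densityConst k := by
  have : (0 : ℝ) < k := by exact_mod_cast Nat.pos_of_ne_zero hk
  unfold densityConst
  positivity

section Density

variable {s b q Λ : ℝ}

/-- In this section s stands for √n, Λ for log n, and q for the grid probability; q ≥ p/2 explains
the halved constant. The bound b ≤ n trades b^k for s^(2k). -/
theorem density_mul_pow_le (hb0 : 0 < b) (hbs : b ≤ s ^ 2) (hs : 1 ≤ s) (hq : 0 ≤ q)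
    (h : densityConst k / 2 * s ^ (3 * k) * Λ ^ 3 ≤ q * b ^ (2 * k)) :
    densityConst k / 2 * s ^ k * Λ ^ 3 ≤ q * b ^ k := by
  have hs0 : 0 < s := by linarith
  have h1 : b ^ k ≤ s ^ (2 * k) := by
    rw [pow_mul]; exact pow_le_pow_left₀ hb0.le hbs k
  refine le_of_mul_le_mul_right ?_ (show 0 < s ^ (2 * k) by positivity)
  calc _ = densityConst k / 2 * s ^ (3 * k) * Λ ^ 3 := by ring
    _ ≤ q * b ^ (2 * k) := h
    _ = q * b ^ k * b ^ k := by ring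
    _ ≤ _ := mul_le_mul_of_nonneg_left h1 (by positivity)

theorem density_le (hb0 : 0 < b) (hbs : b ≤ s ^ 2) (hs : 1 ≤ s) (hq : 0 ≤ q)
    (h : densityConst k / 2 * s ^ (3 * k) * Λ ^ 3 ≤ q * b ^ (2 * k)) :
    densityConst k / 2 * Λ ^ 3 ≤ s ^ k * q := by
  have hs0 : 0 < s := by linarith
  have h1 : b ^ k ≤ s ^ (2 * k) := by
    rw [pow_mul]; exact pow_le_pow_left₀ hb0.le hbs k
  refine le_of_mul_le_mul_right ?_ (show 0 < s ^ k by positivity)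
  calc _ = densityConst k / 2 * s ^ k * Λ ^ 3 := by ring
    _ ≤ q * b ^ k := density_mul_pow_le hb0 hbs hs hq h
    _ ≤ q * s ^ (2 * k) := mul_le_mul_of_nonneg_left h1 hq
    _ = _ := by ring

/-- One factor b is traded for s², which is affordable because 2k + 2 ≤ 3k. -/
theorem density_mul_pow_pred_le (hk : 2 ≤ k) (hb0 : 0 < b) (hbs : b ≤ s ^ 2) (hs : 1 ≤ s)
    (hq : 0 ≤ q) (hΛ : 1 ≤ Λ)
    (h : densityConst k / 2 * s ^ (3 * k) * Λ ^ 3 ≤ q * b ^ (2 * k)) :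
    densityConst k / 2 * s ^ (2 * k) * Λ ^ 3 ≤ q * b ^ (2 * k - 1) := by
  have hC := densityConst_pos (k := k) (by omega)
  have hs0 : 0 < s := by linarith
  refine le_of_mul_le_mul_right ?_ (show 0 < s ^ 2 by positivity)
  calc _ = densityConst k / 2 * Λ ^ 3 * s ^ (2 * k + 2) := by ring
    _ ≤ densityConst k / 2 * Λ ^ 3 * s ^ (3 * k) :=
        mul_le_mul_of_nonneg_left (pow_le_pow_right₀ hs (by omega)) (by positivity)
    _ = densityConst k / 2 * s ^ (3 * k) * Λ ^ 3 := by ring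
    _ ≤ q * b ^ (2 * k) := h
    _ = q * b ^ (2 * k - 1) * b := by
        rw [mul_assoc, ← pow_succ, Nat.sub_add_cancel (by omega)]
    _ ≤ _ := mul_le_mul_of_nonneg_left hbs (by positivity)

theorem le_cube (hΛ : 1 ≤ Λ) : Λ ≤ Λ ^ 3 := le_self_pow₀ hΛ (by norm_num)

/-- Since b ≥ 2k, b + 1 - k ≥ b/2 and the main term is at least q²b^(2k-1)/4^(k-1). The correction
for masked terms uses at most half of this; the other half is left as the margin for the trace. -/
theorem form_bound_le (hk : 2 ≤ k) {b : ℕ} (hb : 2 * k ≤ b) (hbs : (b : ℝ) ≤ s ^ 2) (hs : 1 ≤ s)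
    (hq : 0 ≤ q) (hq1 : q ≤ 1) (hΛ : 1 ≤ Λ)
    (h : densityConst k / 2 * s ^ (3 * k) * Λ ^ 3 ≤ q * b ^ (2 * k)) :
    k ^ k * (q * s ^ (2 * k) * Λ + q ^ 2 * s ^ (2 * k)) + q ^ 2 * b ^ (2 * k - 1) / (2 * 4 ^ (k - 1)) ≤
      b * (q * (b + 1 - k : ℕ) ^ (k - 1)) ^ 2 := by
  have hb0 : (0 : ℝ) < b := by exact_mod_cast (by omega : 0 < b)
  have h1 := density_mul_pow_pred_le hk hb0 hbs hs hq hΛ h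
  have hs0 : 0 < s := by linarith
  have hkk : (0 : ℝ) ≤ (k : ℝ) ^ k := by positivity
  have h48 : (4 : ℝ) ^ k ≤ 8 ^ k := pow_le_pow_left₀ (by norm_num) (by norm_num) k
  have h4 : (4 : ℝ) ^ k = 4 * 4 ^ (k - 1) := by
    rw [← pow_succ', Nat.sub_add_cancel (by omega)]
  have hlow : (b : ℝ) ^ (2 * k - 1) / 4 ^ (k - 1) ≤ b * ((b + 1 - k : ℕ) ^ (k - 1)) ^ 2 := by
    have h2 : (b : ℝ) / 2 ≤ (b + 1 - k : ℕ) := by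
      rw [div_le_iff₀ (by norm_num)]
      exact_mod_cast (by omega)
    calc (b : ℝ) ^ (2 * k - 1) / 4 ^ (k - 1) = b * ((b / 2) ^ (k - 1)) ^ 2 := by
          rw [div_pow, div_pow, ← pow_mul 2, mul_comm (k - 1) 2, pow_mul 2,
            show 2 * k - 1 = 2 * (k - 1) + 1 by omega]
          norm_num
          ring
      _ ≤ _ := by gcongr
  have hmain : k ^ k * (q * s ^ (2 * k) * Λ + q ^ 2 * s ^ (2 * k)) ≤
      q ^ 2 * b ^ (2 * k - 1) / (2 * 4 ^ (k - 1)) := by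
    rw [le_div_iff₀ (by positivity)]
    have e1 : q ^ 2 * s ^ (2 * k) ≤ q * s ^ (2 * k) * Λ := by
      rw [sq, mul_assoc, mul_comm q (q * _), mul_assoc, mul_assoc]
      have : q ≤ Λ := hq1.trans hΛ
      have : 0 ≤ q * s ^ (2 * k) := by positivity
      nlinarith
    calc _ ≤ k ^ k * (q * s ^ (2 * k) * Λ + q * s ^ (2 * k) * Λ) * (2 * 4 ^ (k - 1)) := by
          gcongr
      _ = q * ((4 : ℝ) ^ k * k ^ k * s ^ (2 * k) * Λ) := by rw [h4]; ring
      _ ≤ q * (densityConst k / 2 * s ^ (2 * k) * Λ ^ 3) := by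
          refine mul_le_mul_of_nonneg_left ?_ hq
          have : (4 : ℝ) ^ k * k ^ k ≤ densityConst k / 2 := by
            rw [densityConst]
            nlinarith [mul_le_mul_of_nonneg_right h48 hkk,
              show (0 : ℝ) ≤ 8 ^ k * k ^ k by positivity]
          have := le_cube hΛ
          have := (densityConst_pos (k := k) (by omega)).le
          gcongr
      _ ≤ q * (q * b ^ (2 * k - 1)) := mul_le_mul_of_nonneg_left h1 hq
      _ = _ := by ring
  calc _ ≤ q ^ 2 * b ^ (2 * k - 1) / (2 * 4 ^ (k - 1)) +
        q ^ 2 * b ^ (2 * k - 1) / (2 * 4 ^ (k - 1)) := by linarith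
    _ = q ^ 2 * (b ^ (2 * k - 1) / 4 ^ (k - 1)) := by field_simp; ring
    _ ≤ q ^ 2 * (b * ((b + 1 - k : ℕ) ^ (k - 1)) ^ 2) :=
        mul_le_mul_of_nonneg_left hlow (sq_nonneg q)
    _ = _ := by ring

theorem norm_ratio_le (hk : 2 ≤ k) {R : ℝ} (hb0 : 0 < b) (hbs : b ≤ s ^ 2) (hs : 1 ≤ s)
    (hq : 0 < q) (hΛ : 1 ≤ Λ) (hR : R ≤ 28 * k ^ k * Λ)
    (h : densityConst k / 2 * s ^ (3 * k) * Λ ^ 3 ≤ q * b ^ (2 * k)) :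
    4 * R * (s ^ k * q) * (b ^ (k - 1) / (q ^ 2 * b ^ (2 * k - 1) / (2 * 4 ^ (k - 1)))) ≤
      (1 / 2) ^ k := by
  have h1 := density_mul_pow_le hb0 hbs hs hq.le h
  have hs0 : 0 < s := by linarith
  have hC := densityConst_pos (k := k) (by omega)
  have h4 : (4 : ℝ) ^ k = 4 * 4 ^ (k - 1) := by
    rw [← pow_succ', Nat.sub_add_cancel (by omega)]
  have hbk : b ^ (2 * k - 1) = b ^ (k - 1) * b ^ k := by
    rw [← pow_add]; congr 1; omega
  have e : 4 * R * (s ^ k * q) * (b ^ (k - 1) / (q ^ 2 * b ^ (2 * k - 1) / (2 * 4 ^ (k - 1)))) =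
      2 * 4 ^ k * R * s ^ k / (q * b ^ k) := by
    rw [hbk, h4]
    field_simp
  rw [e, div_le_iff₀ (by positivity)]
  calc 2 * 4 ^ k * R * s ^ k ≤ 2 * 4 ^ k * (28 * k ^ k * Λ ^ 3) * s ^ k := by
        have : R ≤ 28 * k ^ k * Λ ^ 3 :=
          hR.trans (mul_le_mul_of_nonneg_left (le_cube hΛ) (by positivity))
        gcongr
    -- Here 2·4^k·28·k^k = 2^(-k)·(56·8^k·k^k), which fixes the value of `densityConst`.
    _ = (1 / 2) ^ k * (densityConst k / 2 * s ^ k * Λ ^ 3) := by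
        rw [densityConst, show (8 : ℝ) ^ k = 4 ^ k * 2 ^ k by rw [← mul_pow]; norm_num,
          div_pow, one_pow]
        field_simp
        ring
    _ ≤ _ := mul_le_mul_of_nonneg_left h1 (by positivity)

/-- This is the requirement a ≥ 1 of the trace bound. -/
theorem le_density (hk : 2 ≤ k) {R : ℝ} (hb0 : 0 < b) (hbs : b ≤ s ^ 2) (hs : 1 ≤ s)
    (hq : 0 ≤ q) (hΛ : 1 ≤ Λ) (hR : R ≤ 28 * k ^ k * Λ)
    (h : densityConst k / 2 * s ^ (3 * k) * Λ ^ 3 ≤ q * b ^ (2 * k)) : R ≤ s ^ k * q := by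
  refine le_trans (hR.trans ?_) (density_le hb0 hbs hs hq h)
  have h8 : (1 : ℝ) ≤ 8 ^ k := one_le_pow₀ (by norm_num)
  have hkk : (0 : ℝ) ≤ (k : ℝ) ^ k := by positivity
  have hc : 28 * (k : ℝ) ^ k ≤ densityConst k / 2 := by
    rw [densityConst]
    nlinarith [mul_le_mul_of_nonneg_right h8 hkk]
  have := le_cube hΛ
  have hC := densityConst_pos (k := k) (by omega)
  exact mul_le_mul hc this (by linarith) (by linarith)

end Density

/-- The failure probability for one value of `n`. -/
theorem random_real_refute_le_of_density (hk : 2 ≤ k) (p : unitInterval) {b : ℕ} {β : ℝ}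
    (hlog : 1 ≤ Real.log n) (hb : 2 * k ≤ b) (hbn : b ≤ n) (hβ : 0 < β) (hβb : β ≤ b)
    (h : densityConst k * ((n : ℝ) ^ (5 * (k : ℝ) / 2) * Real.log n ^ 3 / β ^ (2 * k)) ≤
      (p : ℝ) * (n.choose k : ℝ)) :
    (UniformHypergraph.random n k p).real {H | refute k n H b = false} ≤
      2 * ((Real.log n)⁻¹ + (n : ℝ)⁻¹) := by
  have hk0 : k ≠ 0 := by omega
  have hn0 : n ≠ 0 := by omega
  have hC := densityConst_pos hk0
  set s := Real.sqrt n
  have hsn : s ^ 2 = n := Real.sq_sqrt (Nat.cast_nonneg n)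
  have hs : 1 ≤ s := Real.one_le_sqrt.2 (by exact_mod_cast Nat.pos_of_ne_zero hn0)
  have hs0 : 0 < s := by linarith
  have hb0 : (0 : ℝ) < b := hβ.trans_le hβb
  have hbs : (b : ℝ) ≤ s ^ 2 := by rw [hsn]; exact_mod_cast hbn
  have hpow : (n : ℝ) ^ (5 * (k : ℝ) / 2) = s ^ (5 * k) := by
    rw [← Real.rpow_natCast, ← hsn, ← Real.rpow_natCast s 2, ← Real.rpow_mul hs0.le]
    congr 1
    push_cast
    ring
  have hp : densityConst k * s ^ (3 * k) * Real.log n ^ 3 ≤ p * b ^ (2 * k) := by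
    have h1 : (p : ℝ) * n.choose k ≤ p * s ^ (2 * k) := by
      refine mul_le_mul_of_nonneg_left ?_ p.2.1
      rw [pow_mul, hsn]
      exact_mod_cast Nat.choose_le_pow n k
    rw [hpow] at h
    have h2 := h.trans h1
    rw [mul_div_assoc', div_le_iff₀ (by positivity)] at h2
    refine le_of_mul_le_mul_right ?_ (show 0 < s ^ (2 * k) by positivity)
    calc _ = densityConst k * (s ^ (5 * k) * Real.log n ^ 3) := by ring
      _ ≤ p * s ^ (2 * k) * β ^ (2 * k) := h2
      _ ≤ p * s ^ (2 * k) * b ^ (2 * k) :=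
          mul_le_mul_of_nonneg_left (pow_le_pow_left₀ hβ.le hβb _) (mul_nonneg p.2.1 (by positivity))
      _ = _ := by ring
  have hlogpos : 0 < Real.log n := by linarith
  have hp0 : 0 < (p : ℝ) := by
    refine pos_of_mul_pos_left (lt_of_lt_of_le ?_ hp) (by positivity)
    positivity
  obtain ⟨j, hj, hpj, hP⟩ := random_real_refute_le (k := k) (Nat.one_le_pow k n (by omega)) p b
  set q : ℝ := (j : ℝ) / (4 * n ^ k : ℕ) with hq_def
  have hq0 : 0 < q := by linarith
  have hq1 : q ≤ 1 := div_le_one_of_le₀ (by exact_mod_cast hj) (by positivity)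
  have hq : densityConst k / 2 * s ^ (3 * k) * Real.log n ^ 3 ≤ q * b ^ (2 * k) := by
    have : (p : ℝ) / 2 * b ^ (2 * k) ≤ q * b ^ (2 * k) :=
      mul_le_mul_of_nonneg_right hpj (by positivity)
    linarith
  have hR := two_pow_squarings_le_log (k := k) hlog
  have hsk : (n : ℝ) ^ k = s ^ (2 * k) := by rw [pow_mul, hsn]
  -- The threshold T is log n times the bound n^k·q on the expected edge count, so Markov's
  -- inequality contributes 1/log n.
  have hE := expect_refute_eq_false_le (k := k) hk hn0 (b := b) (T := q * s ^ (2 * k) * Real.log n)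
    (G := q ^ 2 * b ^ (2 * k - 1) / (2 * 4 ^ (k - 1))) hj hq_def (by positivity) (by positivity)
    (by rw [hsk]; exact form_bound_le hk hb hbs hs hq0.le hq1 hlog hq) hs hsn
    (le_density hk hb0 hbs hs hq0.le hlog hR hq)
  refine hP.trans (mul_le_mul_of_nonneg_left (hE.trans (add_le_add ?_ ?_)) (by norm_num))
  · rw [hsk]
    refine le_of_eq ?_
    field_simp
  · have hratio := norm_ratio_le hk hb0 hbs hs hq0 hlog hR hq
    have hn' : (0 : ℝ) < n := by exact_mod_cast Nat.pos_of_ne_zero hn0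
    calc _ ≤ (n : ℝ) ^ (k - 1) * ((1 / 2) ^ k) ^ 2 ^ squarings n := by
          refine mul_le_mul_of_nonneg_left (pow_le_pow_left₀ (by positivity) hratio _)
            (by positivity)
      _ = (n : ℝ) ^ (k - 1) / ((2 : ℝ) ^ 2 ^ squarings n) ^ k := by
          rw [← pow_mul, mul_comm k, pow_mul, div_pow, one_pow, div_pow, one_pow, mul_one_div]
      _ ≤ (n : ℝ) ^ (k - 1) / n ^ k := by
          refine div_le_div_of_nonneg_left (by positivity) (by positivity) ?_
          refine pow_le_pow_left₀ hn'.le ?_ k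
          exact_mod_cast (lt_two_pow_two_pow_squarings n).le
      _ = _ := by
          rw [show (n : ℝ) ^ k = n ^ (k - 1) * n by
            rw [← pow_succ, Nat.sub_add_cancel (by omega)]]
          field_simp

theorem tendsto_random_real_refute (hk : 2 ≤ k) (p : ℕ → unitInterval) (β : ℕ → ℝ)
    (hβ : ∀ᶠ n : ℕ in atTop, (n : ℝ) ^ (3 / 4 : ℝ) * Real.log n ≤ β n)
    (hp : ∀ᶠ n : ℕ in atTop,
      densityConst k * ((n : ℝ) ^ (5 * (k : ℝ) / 2) * Real.log n ^ 3 / β n ^ (2 * k)) ≤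
        (p n : ℝ) * (n.choose k : ℝ)) :
    Tendsto (fun n : ℕ => (UniformHypergraph.random n k (p n)).real
      {H | refute k n H ⌈β n⌉₊ = false}) atTop (𝓝 0) := by
  have hlog : Tendsto (fun n : ℕ => Real.log n) atTop atTop :=
    Real.tendsto_log_atTop.comp tendsto_natCast_atTop_atTop
  have hlim : Tendsto (fun n : ℕ => 2 * ((Real.log n)⁻¹ + (n : ℝ)⁻¹)) atTop (𝓝 0) := by
    have h := (hlog.inv_tendsto_atTop.add
      (tendsto_natCast_atTop_atTop (R := ℝ)).inv_tendsto_atTop).const_mul 2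
    simpa using h
  refine squeeze_zero' (Eventually.of_forall fun n => MeasureTheory.measureReal_nonneg) ?_ hlim
  filter_upwards [hβ, hp, hlog.eventually_ge_atTop 1, hlog.eventually_ge_atTop (2 * k : ℝ),
    eventually_ge_atTop 1] with n h1 h2 h3 h4 h5
  -- Together with log n ≥ 2k for large n, this yields ⌈β⌉ ≥ 2k.
  have hβlog : Real.log n ≤ β n := by
    refine le_trans ?_ h1
    have : (1 : ℝ) ≤ (n : ℝ) ^ (3 / 4 : ℝ) :=
      Real.one_le_rpow (by exact_mod_cast h5) (by norm_num)
    nlinarith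
  rcases le_or_gt ⌈β n⌉₊ n with hle | hgt
  · refine random_real_refute_le_of_density hk (p n) h3 ?_ hle (by linarith) (Nat.le_ceil _) h2
    have := (h4.trans hβlog).trans (Nat.le_ceil (β n))
    exact_mod_cast this
  -- For ⌈β⌉ > n the algorithm always refutes, so failure is impossible.
  · have hempty : {H : UniformHypergraph n k | refute k n H ⌈β n⌉₊ = false} = ∅ := by
      ext H
      have := (refute_iff (by omega : k ≠ 0) H ⌈β n⌉₊).2 (.inl hgt)
      simp [this]
    rw [hempty, MeasureTheory.measureReal_empty]
    positivity

end Refutation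

theorem mainTheorem11 (k : ℕ) (hk : 2 ≤ k) :
    ∃ (C : ℝ) (A : (n : ℕ) → UniformHypergraph n k → ℕ → Bool), 0 < C ∧
      RAM.DecidesInPolyTime
        (fun x : (n : ℕ) × UniformHypergraph n k × ℕ => UniformHypergraph.encode x.2.1 x.2.2)
        (fun x => A x.1 x.2.1 x.2.2) ∧
      (∀ (n : ℕ) (H : UniformHypergraph n k) (b : ℕ), A n H b = true → H.indepNumber < b) ∧
      ∀ (p : ℕ → unitInterval) (β : ℕ → ℝ),
        (∀ᶠ n : ℕ in atTop, (n : ℝ) ^ (3 / 4 : ℝ) * Real.log n ≤ β n) →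
        (∀ᶠ n : ℕ in atTop,
          C * ((n : ℝ) ^ (5 * (k : ℝ) / 2) * Real.log n ^ 3 / β n ^ (2 * k)) ≤
            (p n : ℝ) * (n.choose k : ℝ)) →
        Tendsto
          (fun n : ℕ => (UniformHypergraph.random n k (p n)).real
            {H | A n H ⌈β n⌉₊ = false})
          atTop (𝓝 0) :=
  have hk0 : k ≠ 0 := by omega
  ⟨Refutation.densityConst k, Refutation.refute k, Refutation.densityConst_pos hk0,
    Refutation.refute_decidesInPolyTime hk0,
    fun _ H b => Refutation.indepNumber_lt_of_refute hk0 H b,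
    fun p β hβ hp => Refutation.tendsto_random_real_refute hk p β hβ hp⟩
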